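/- **Conventions.** For $0<\alpha<1$, $S_\alpha$ denotes a positive $\alpha$-stable random variable: $S_\alpha>0$ a.s. and $\mathbb E e^{-tS_\alpha}=e^{-t^\alpha}$ for $t>0$. For a positive random variable $X$ put $\rho_+=\sup\{s\in\mathbb R:\mathbb E X^s<\infty\}$ and $\rho_-=\inf\{s\in\mathbb R:\mathbb E X^s<\infty\}$. $X$ has *moments of Gamma type* (on a strip) if there $\mathbb E X^s=C D^s\prod_{j=1}^J\Gamma(a_js+b_j)\big/\prod_{k=1}^K\Gamma(a_k's+b_k')$ for some real constants $C$, $D>0$, $a_j\neq0$, $b_j$, $a_k'\ne0$, $b_k'$; then one sets $\gamma=\sum_j|a_j|-\sum_k|a_k'|$, $\gamma'=\sum_j a_j-\sum_k a_k'$, $\delta=\sum_j b_j-\sum_k b_k'-\frac{J-K}2$, $\kappa=\sum_j a_j\log|a_j|-\sum_k a_k'\log|a_k'|+\log D$, $C_1=C(2\pi)^{(J-K)/2}\prod_j|a_j|^{b_j-1/2}\big/\prod_k|a'_k|^{b'_k-1/2}$. All moments below are absolutely convergent expectations for complex $s$; the expressions containing $\sin$ in a denominator, or $\Gamma(s)$,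 are asserted for $s\neq 0$ (at $s=0$ the moment is $1$). **(i) Lamperti variables.** Let $0<\alpha<1$ and $L_\alpha=S_\alpha/S_\alpha'$, where $S_\alpha,S_\alpha'$ are independent positive $\alpha$-stable variables. For $-\alpha<\operatorname{Re}s<\alpha$, $$\mathbb E L_\alpha^s=\mathbb E S_\alpha^s\,\mathbb E S_\alpha^{-s}=\frac{\Gamma(1-s/\alpha)\Gamma(1+s/\alpha)}{\Gamma(1-s)\Gamma(1+s)}=\frac{\Gamma(s/\alpha)\Gamma(1-s/\alpha)}{\alpha\Gamma(s)\Gamma(1-s)}=\frac{\sin(\pi s)}{\alpha\sin(\pi s/\alpha)},$$ so $L_\alpha$ has moments of Gamma type, with $\rho_\pm=\pm\alpha$, $\gamma=2\alpha^{-1}-2$, $\gamma'=\delta=\kappa=0$, $C_1=1/\alpha$. Further, $L_\alpha^\alpha=M'_\alpha/M_\alpha$ a.s., where $M_\alpha=S_\alpha^{-\alpha}$, $M_\alpha'=(S'_\alpha)^{-\alpha}$ are i.i.d. with the Mittag-Leffler distribution (the positive distribution with $\mathbb E e^{tM_\alpha}=\sum_{n\ge0}t^n/\Gamma(1+\alpha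 n)$, $t\in\mathbb R$), and for $-1<\operatorname{Re}s<1$, $$\mathbb E(L_\alpha^\alpha)^s=\frac{\Gamma(1-s)\Gamma(1+s)}{\Gamma(1-\alpha s)\Gamma(1+\alpha s)}=\frac{\sin(\pi\alpha s)}{\alpha\sin(\pi s)},$$ so $L_\alpha^\alpha$ has moments of Gamma type, with $\rho_\pm=\pm1$, $\gamma=2-2\alpha$, $\gamma'=\delta=\kappa=0$, $C_1=1/\alpha$. The densities on $(0,\infty)$ of $L_\alpha^\alpha$ and $L_\alpha$ are, respectively, $$\frac{\sin(\pi\alpha)}{\pi\alpha}\,\frac1{x^2+2\cos(\pi\alpha)x+1},\qquad \frac{\sin(\pi\alpha)}{\pi}\,\frac{x^{\alpha-1}}{x^{2\alpha}+2\cos(\pi\alpha)x^\alpha+1}.$$ For $\alpha=1/2$, $\mathbb E(L_{1/2}^{1/2})^s=1/\cos(\pi s/2)$ for $-1<\operatorname{Re}s<1$, and $L_{1/2}^{1/2}$ has the law of the absolute value of a standard Cauchy variable. **(ii) Kotz–Ostrovskii variables.** Let $0<\alpha<\beta\le2$ and $Y_{\alpha,\beta}=(L_{\alpha/\beta}^{\alpha/\beta})^{1/\alpha}=L_{\alpha/\beta}^{1/\beta}$.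 For $-\alpha<\operatorname{Re}s<\alpha$, $$\mathbb E Y_{\alpha,\beta}^s=\mathbb E L_{\alpha/\beta}^{s/\beta}=\frac{\Gamma(1+s/\alpha)\Gamma(1-s/\alpha)}{\Gamma(1+s/\beta)\Gamma(1-s/\beta)}=\frac{\beta\sin(\pi s/\beta)}{\alpha\sin(\pi s/\alpha)},$$ so $Y_{\alpha,\beta}$ has moments of Gamma type, with $\rho_\pm=\pm\alpha$, $\gamma=2\alpha^{-1}-2\beta^{-1}$, $\gamma'=\delta=\kappa=0$, $C_1=\beta/\alpha$. **(iii) James's variables.** Let $0<\alpha<1$, $\theta>-\alpha$, and $X_{\alpha,\theta}=S_\alpha/S_{\alpha,\theta}$, where $S_\alpha$ and $S_{\alpha,\theta}$ are independent and the law of $S_{\alpha,\theta}$ is the law of $S_\alpha$ tilted by $x^{-\theta}$, i.e. $\mathbb P(S_{\alpha,\theta}\in dx)=x^{-\theta}\,\mathbb P(S_\alpha\in dx)/\mathbb E S_\alpha^{-\theta}$ (where $0<\mathbb E S_\alpha^{-\theta}<\infty$). Both $S_{\alpha,\theta}$ and $X_{\alpha,\theta}$ have moments of Gamma type: $$\mathbb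 E S_{\alpha,\theta}^s=\frac{\mathbb E S_\alpha^{s-\theta}}{\mathbb E S_\alpha^{-\theta}}=\frac{\Gamma(1+\theta)}{\Gamma(1+\theta/\alpha)}\,\frac{\Gamma(1-s/\alpha+\theta/\alpha)}{\Gamma(1-s+\theta)},\qquad \operatorname{Re}s<\alpha+\theta,$$ $$\mathbb E X_{\alpha,\theta}^s=\mathbb E S_\alpha^s\,\mathbb E S_{\alpha,\theta}^{-s}=\frac{\Gamma(1+\theta)}{\Gamma(1+\theta/\alpha)}\,\frac{\Gamma(1-s/\alpha)\Gamma(1+s/\alpha+\theta/\alpha)}{\Gamma(1-s)\Gamma(1+s+\theta)},\qquad-\alpha-\theta<\operatorname{Re}s<\alpha,$$ and $X_{\alpha,\theta}$ has $\rho_+=\alpha$, $\rho_-=-\alpha-\theta$, $\gamma=2(1/\alpha-1)$, $\gamma'=0$, $\delta=\theta(1/\alpha-1)$, $\kappa=0$. -/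

import Mathlib

open MeasureTheory ProbabilityTheory

namespace GammaMoments

noncomputable section

/-- `X` is (a.s.) a positive random variable with the positive `α`-stable distribution, i.e. its
Laplace transform is `E exp (-t X) = exp (-t ^ α)` for `t > 0`. -/
structure IsPositiveStable {Ω : Type*} [MeasurableSpace Ω] (α : ℝ) (X : Ω → ℝ)
    (μ : Measure Ω) : Prop where
  aemeasurable : AEMeasurable X μ
  pos : ∀ᵐ ω ∂μ, 0 < X ω
  laplace : ∀ t : ℝ, 0 < t → ∫ ω, Real.exp (-t * X ω) ∂μ = Real.exp (-t ^ α)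

/-- `M` is (a.s.) a positive random variable with the Mittag-Leffler distribution of index `α`:
its moment generating function is the Mittag-Leffler function,
`E exp (t M) = ∑ tⁿ / Γ(1 + α n)` for all real `t`. -/
structure IsMittagLeffler {Ω : Type*} [MeasurableSpace Ω] (α : ℝ) (M : Ω → ℝ)
    (μ : Measure Ω) : Prop where
  aemeasurable : AEMeasurable M μ
  pos : ∀ᵐ ω ∂μ, 0 < M ω
  integrable_exp : ∀ t : ℝ, Integrable (fun ω => Real.exp (t * M ω)) μ
  mgf : ∀ t : ℝ, HasSum (fun n : ℕ => t ^ n / Real.Gamma (1 + α * n))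
    (∫ ω, Real.exp (t * M ω) ∂μ)

/-- The complex moment `E X ^ s` of a positive random variable `X`. -/
def cmoment {Ω : Type*} [MeasurableSpace Ω] (μ : Measure Ω) (X : Ω → ℝ) (s : ℂ) : ℂ :=
  ∫ ω, (X ω : ℂ) ^ s ∂μ

/-- The complex moment `E X ^ s` exists (as an absolutely convergent integral) and equals `v`. -/
def HasMoment {Ω : Type*} [MeasurableSpace Ω] (μ : Measure Ω) (X : Ω → ℝ) (s v : ℂ) : Prop :=
  Integrable (fun ω => (X ω : ℂ) ^ s) μ ∧ cmoment μ X s = v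

/-- `ρ₊ = sup {s : E X ^ s < ∞}`, for a positive random variable `X`. -/
def rhoPlus {Ω : Type*} [MeasurableSpace Ω] (μ : Measure Ω) (X : Ω → ℝ) : EReal :=
  sSup ((fun s : ℝ => (s : EReal)) '' {s : ℝ | Integrable (fun ω => X ω ^ s) μ})

/-- `ρ₋ = inf {s : E X ^ s < ∞}`, for a positive random variable `X`. -/
def rhoMinus {Ω : Type*} [MeasurableSpace Ω] (μ : Measure Ω) (X : Ω → ℝ) : EReal :=
  sInf ((fun s : ℝ => (s : EReal)) '' {s : ℝ | Integrable (fun ω => X ω ^ s) μ})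

/-- The law `ν` on `(0, ∞)` tilted by `x ^ r`: the measure `x ^ r / (∫ y ^ r dν(y)) dν(x)`. -/
def powTilt (ν : Measure ℝ) (r : ℝ) : Measure ℝ :=
  ν.withDensity fun x => ENNReal.ofReal (x ^ r / ∫ y, y ^ r ∂ν)

/-- `X` is a positive random variable with density `f` on `(0, ∞)`. -/
def HasPosDensity {Ω : Type*} [MeasurableSpace Ω] (μ : Measure Ω) (X : Ω → ℝ)
    (f : ℝ → ℝ) : Prop :=
  HasLaw X ((volume.restrict (Set.Ioi 0)).withDensity fun x => ENNReal.ofReal (f x)) μ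

/-- The data of a function `C D ^ s ∏ⱼ Γ(aⱼ s + bⱼ) / ∏ₖ Γ(a'ₖ s + b'ₖ)` of Gamma type, with real
parameters. -/
structure GammaData where
  J : ℕ
  K : ℕ
  C : ℝ
  D : ℝ
  a : Fin J → ℝ
  b : Fin J → ℝ
  a' : Fin K → ℝ
  b' : Fin K → ℝ
  D_pos : 0 < D
  a_ne : ∀ j, a j ≠ 0
  a'_ne : ∀ k, a' k ≠ 0

namespace GammaData

/-- The function `C D ^ s ∏ⱼ Γ(aⱼ s + bⱼ) / ∏ₖ Γ(a'ₖ s + b'ₖ)`. -/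
def fn (g : GammaData) (s : ℂ) : ℂ :=
  (g.C : ℂ) * (g.D : ℂ) ^ s * (∏ j, Complex.Gamma (g.a j * s + g.b j)) /
    ∏ k, Complex.Gamma (g.a' k * s + g.b' k)

/-- `γ = ∑ |aⱼ| - ∑ |a'ₖ|`. -/
def gam (g : GammaData) : ℝ := ∑ j, |g.a j| - ∑ k, |g.a' k|

/-- `γ' = ∑ aⱼ - ∑ a'ₖ`. -/
def gam' (g : GammaData) : ℝ := ∑ j, g.a j - ∑ k, g.a' k

/-- `δ = ∑ bⱼ - ∑ b'ₖ - (J - K) / 2`. -/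
def del (g : GammaData) : ℝ := ∑ j, g.b j - ∑ k, g.b' k - ((g.J : ℝ) - g.K) / 2

/-- `κ = ∑ aⱼ log |aⱼ| - ∑ a'ₖ log |a'ₖ| + log D`. -/
def kap (g : GammaData) : ℝ :=
  ∑ j, g.a j * Real.log |g.a j| - ∑ k, g.a' k * Real.log |g.a' k| + Real.log g.D

/-- `C₁ = C (2π) ^ ((J - K) / 2) ∏ |aⱼ| ^ (bⱼ - 1/2) / ∏ |a'ₖ| ^ (b'ₖ - 1/2)`. -/
def C₁ (g : GammaData) : ℝ :=
  g.C * (2 * Real.pi) ^ (((g.J : ℝ) - g.K) / 2) * (∏ j, |g.a j| ^ (g.b j - 1 / 2)) /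
    ∏ k, |g.a' k| ^ (g.b' k - 1 / 2)

end GammaData

/-- The positive random variable `X` has moments of Gamma type on the strip `U`, given by the
function with data `g`. -/
def IsGammaType {Ω : Type*} [MeasurableSpace Ω] (μ : Measure Ω) (X : Ω → ℝ) (U : Set ℂ)
    (g : GammaData) : Prop :=
  (∀ᵐ ω ∂μ, 0 < X ω) ∧ ∀ s ∈ U, HasMoment μ X s (g.fn s)

end

end GammaMoments

open GammaMoments

/-! Everything rests on the Mellin transform of the positive stable law. For p > 0, Euler's integral
Γ(p) x^(-p) = ∫ t^(p-1) e^(-tx) dt and Tonelli turn the Laplace transform into E S^(-p) = Γ(1 + p/α)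
/ Γ(1 + p) (`IsPositiveStable.lintegral_rpow_neg`). A Markov-type tail bound makes E S^s finite for
all real s < α (`tail_bound`, `integrable_rpow`). Since E X^s is the complex moment generating
function of log X, it is holomorphic, and the identity theorem carries the formula to the half-plane
Re s < α. The exponent α is sharp because Γ(1 - s/α) blows up there (`lt_of_integrable_rpow`).

Independence multiplies moments of quotients, and tilting by x^(-θ) only translates the Mellin
variable. This gives all the Gamma quotients; the reflection formula turns the untilted ones into
sines. Conversely, integrability of an independent quotient forces that of both factors, so the
strips cannot be enlarged.

A positive law is determined by its moments on a strip around Re s = 0, because that strip contains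
the characteristic function of log X. The densities therefore follow from the Mellin transform of 1
/ (x² + 2x cos θ + 1), found by splitting x^(a-1) / (e^(-iθ/2) x + e^(iθ/2)) into real and imaginary
parts (`cauchyKernel_mellin_aux`). The Mittag-Leffler law comes from E S^(-αn) = n! / Γ(1 + αn), by
integrating the exponential series termwise. -/

namespace GammaMoments

/-! ### Complex moments of positive variables: analyticity, uniqueness, quotients, powers -/

section Toolkit

variable {Ω : Type*} [MeasurableSpace Ω] {μ : Measure Ω} {X Y : Ω → ℝ}

lemma ofReal_cpow_eq_exp {x : ℝ} (hx : 0 < x) (s : ℂ) :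
    (x : ℂ) ^ s = Complex.exp (s * (Real.log x : ℝ)) := by
  rw [Complex.cpow_def_of_ne_zero (by exact_mod_cast hx.ne'), Complex.ofReal_log hx.le, mul_comm]

/-- Passing to log X makes the holomorphy of complex moment generating functions, and their link
with characteristic functions, available for moments. -/
lemma cmoment_eq_complexMGF (hX : ∀ᵐ ω ∂μ, 0 < X ω) (s : ℂ) :
    cmoment μ X s = complexMGF (fun ω => Real.log (X ω)) μ s := by
  refine integral_congr_ae ?_
  filter_upwards [hX] with ω hω
  exact ofReal_cpow_eq_exp hω s

lemma integrable_cpow_iff (hm : AEMeasurable X μ) (hX : ∀ᵐ ω ∂μ, 0 < X ω) (s : ℂ) :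
    Integrable (fun ω => (X ω : ℂ) ^ s) μ ↔ Integrable (fun ω => X ω ^ s.re) μ := by
  have h1 : AEStronglyMeasurable (fun ω => (X ω : ℂ) ^ s) μ :=
    (Complex.measurable_ofReal.comp_aemeasurable hm).pow_const s |>.aestronglyMeasurable
  rw [← integrable_norm_iff h1]
  refine integrable_congr ?_
  filter_upwards [hX] with ω hω
  exact Complex.norm_cpow_eq_rpow_re_of_pos hω s

lemma mem_integrableExpSet_log_iff (hX : ∀ᵐ ω ∂μ, 0 < X ω) (s : ℝ) :
    s ∈ integrableExpSet (fun ω => Real.log (X ω)) μ ↔ Integrable (fun ω => X ω ^ s) μ := by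
  refine integrable_congr ?_
  filter_upwards [hX] with ω hω
  rw [Real.rpow_def_of_pos hω, mul_comm]

lemma cmoment_ofReal (hX : ∀ᵐ ω ∂μ, 0 < X ω) (s : ℝ) :
    cmoment μ X s = ((∫ ω, X ω ^ s ∂μ : ℝ) : ℂ) := by
  rw [← integral_complex_ofReal]
  refine integral_congr_ae ?_
  filter_upwards [hX] with ω hω
  exact (Complex.ofReal_cpow hω.le s).symm

lemma differentiableOn_cmoment (hX : ∀ᵐ ω ∂μ, 0 < X ω) {I : Set ℝ} (hI : IsOpen I)
    (hint : ∀ s ∈ I, Integrable (fun ω => X ω ^ s) μ) :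
    DifferentiableOn ℂ (cmoment μ X) (Complex.re ⁻¹' I) := by
  have h : Complex.re ⁻¹' I ⊆
      {z | z.re ∈ interior (integrableExpSet (fun ω => Real.log (X ω)) μ)} := fun z hz =>
    interior_maximal (fun s hs => (mem_integrableExpSet_log_iff hX s).2 (hint s hs)) hI hz
  refine (differentiableOn_complexMGF.mono h).congr fun s _ => cmoment_eq_complexMGF hX s

/-- Identity theorem on a vertical strip: agreement on a real interval suffices. -/
lemma eqOn_strip_of_eq_real {f g : ℂ → ℂ} {I : Set ℝ} (hI : IsOpen I) (hI' : I.OrdConnected)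
    (hf : DifferentiableOn ℂ f (Complex.re ⁻¹' I)) (hg : DifferentiableOn ℂ g (Complex.re ⁻¹' I))
    {c d : ℝ} (hcd : c < d) (hsub : Set.Ioo c d ⊆ I)
    (h : ∀ s : ℝ, c < s → s < d → f s = g s) : Set.EqOn f g (Complex.re ⁻¹' I) := by
  have ho : IsOpen (Complex.re ⁻¹' I) := hI.preimage Complex.continuous_re
  have hconv : Convex ℝ (Complex.re ⁻¹' I) :=
    hI'.convex.is_linear_preimage Complex.reLm.isLinear
  obtain ⟨m, hm1, hm2⟩ := exists_between hcd
  have hmI : ((m : ℝ) : ℂ) ∈ Complex.re ⁻¹' I := by simpa using hsub ⟨hm1, hm2⟩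
  refine (hf.analyticOnNhd ho).eqOn_of_preconnected_of_frequently_eq (hg.analyticOnNhd ho)
    hconv.isPreconnected hmI ?_
  -- Real points other than `m` accumulate at `m` in ℂ, so agreement on the real interval already
  -- has an accumulation point.
  have ht : Filter.Tendsto (fun x : ℝ => (x : ℂ)) (nhdsWithin m {m}ᶜ)
      (nhdsWithin (m : ℂ) {(m : ℂ)}ᶜ) := by
    refine tendsto_nhdsWithin_iff.2 ⟨(Complex.continuous_ofReal.tendsto m).mono_left
      nhdsWithin_le_nhds, ?_⟩
    filter_upwards [self_mem_nhdsWithin] with x hx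
    simpa using hx
  refine ht.frequently (Filter.Eventually.frequently ?_)
  filter_upwards [nhdsWithin_le_nhds (Ioo_mem_nhds hm1 hm2)] with x hx
  exact h x hx.1 hx.2

lemma hasMoment_of_real (hm : AEMeasurable X μ) (hX : ∀ᵐ ω ∂μ, 0 < X ω) {I : Set ℝ}
    (hI : IsOpen I) (hI' : I.OrdConnected) (hint : ∀ s ∈ I, Integrable (fun ω => X ω ^ s) μ)
    {f : ℂ → ℂ} (hf : DifferentiableOn ℂ f (Complex.re ⁻¹' I))
    {c d : ℝ} (hcd : c < d) (hsub : Set.Ioo c d ⊆ I)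
    (h : ∀ s : ℝ, c < s → s < d → ((∫ ω, X ω ^ s ∂μ : ℝ) : ℂ) = f s) {s : ℂ} (hs : s.re ∈ I) :
    HasMoment μ X s (f s) :=
  ⟨(integrable_cpow_iff hm hX s).2 (hint _ hs),
    eqOn_strip_of_eq_real hI hI' (differentiableOn_cmoment hX hI hint) hf hcd hsub
      (fun r h1 h2 => (cmoment_ofReal hX r).trans (h r h1 h2)) hs⟩

/-- Two positive laws whose real moments exist near `0` and agree on an interval coincide. -/
lemma map_eq_map_of_rpow_moments {Ω' : Type*} [MeasurableSpace Ω'] {ν : Measure Ω'} {Y : Ω' → ℝ}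
    [IsFiniteMeasure μ] [IsFiniteMeasure ν]
    (hXm : AEMeasurable X μ) (hX : ∀ᵐ ω ∂μ, 0 < X ω)
    (hYm : AEMeasurable Y ν) (hY : ∀ᵐ ω ∂ν, 0 < Y ω) {ε : ℝ} (hε : 0 < ε)
    (hXi : ∀ s ∈ Set.Ioo (-ε) ε, Integrable (fun ω => X ω ^ s) μ)
    (hYi : ∀ s ∈ Set.Ioo (-ε) ε, Integrable (fun ω => Y ω ^ s) ν)
    (h : ∀ s : ℝ, 0 < s → s < ε → ∫ ω, X ω ^ s ∂μ = ∫ ω, Y ω ^ s ∂ν) :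
    μ.map X = ν.map Y := by
  have hlX : AEMeasurable (fun ω => Real.log (X ω)) μ := Real.measurable_log.comp_aemeasurable hXm
  have hlY : AEMeasurable (fun ω => Real.log (Y ω)) ν := Real.measurable_log.comp_aemeasurable hYm
  have key := eqOn_strip_of_eq_real isOpen_Ioo Set.ordConnected_Ioo
    (differentiableOn_cmoment hX isOpen_Ioo hXi) (differentiableOn_cmoment hY isOpen_Ioo hYi) hε
    (Set.Ioo_subset_Ioo_left (by linarith)) (fun s h1 h2 => by
      rw [cmoment_ofReal hX, cmoment_ofReal hY, h s h1 h2])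
  have hlog : μ.map (fun ω => Real.log (X ω)) = ν.map (fun ω => Real.log (Y ω)) := by
    refine Measure.ext_of_charFun (funext fun t => ?_)
    -- The characteristic function of log X at t is the moment at s = it, which lies in the strip
    -- because its real part is 0.
    rw [← complexMGF_mul_I hlX, ← complexMGF_mul_I hlY, ← cmoment_eq_complexMGF hX,
      ← cmoment_eq_complexMGF hY]
    exact key (by simpa using hε)
  have h1 : μ.map X = (μ.map (fun ω => Real.log (X ω))).map Real.exp := by
    rw [AEMeasurable.map_map_of_aemeasurable Real.measurable_exp.aemeasurable hlX]
    refine Measure.map_congr ?_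
    filter_upwards [hX] with ω hω
    simp [Real.exp_log hω]
  have h2 : ν.map Y = (ν.map (fun ω => Real.log (Y ω))).map Real.exp := by
    rw [AEMeasurable.map_map_of_aemeasurable Real.measurable_exp.aemeasurable hlY]
    refine Measure.map_congr ?_
    filter_upwards [hY] with ω hω
    simp [Real.exp_log hω]
  rw [h1, h2, hlog]

lemma rpow_div_ae (hX : ∀ᵐ ω ∂μ, 0 < X ω) (hY : ∀ᵐ ω ∂μ, 0 < Y ω) (s : ℝ) :
    ∀ᵐ ω ∂μ, (X ω / Y ω) ^ s = X ω ^ s * Y ω ^ (-s) := by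
  filter_upwards [hX, hY] with ω h1 h2
  rw [Real.div_rpow h1.le h2.le, Real.rpow_neg h2.le, div_eq_mul_inv]

lemma cpow_div_ae (hX : ∀ᵐ ω ∂μ, 0 < X ω) (hY : ∀ᵐ ω ∂μ, 0 < Y ω) (s : ℂ) :
    ∀ᵐ ω ∂μ, ((X ω / Y ω : ℝ) : ℂ) ^ s = (X ω : ℂ) ^ s * (Y ω : ℂ) ^ (-s) := by
  filter_upwards [hX, hY] with ω h1 h2
  rw [ofReal_cpow_eq_exp (div_pos h1 h2), ofReal_cpow_eq_exp h1, ofReal_cpow_eq_exp h2,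
    Real.log_div h1.ne' h2.ne', ← Complex.exp_add]
  push_cast
  ring_nf

lemma HasMoment.div {s v w : ℂ}
    (hX : ∀ᵐ ω ∂μ, 0 < X ω) (hY : ∀ᵐ ω ∂μ, 0 < Y ω) (hXY : IndepFun X Y μ)
    (h1 : HasMoment μ X s v) (h2 : HasMoment μ Y (-s) w) :
    HasMoment μ (fun ω => X ω / Y ω) s (v * w) := by
  have hind : IndepFun (fun ω => (X ω : ℂ) ^ s) (fun ω => (Y ω : ℂ) ^ (-s)) μ :=
    hXY.comp (φ := fun x : ℝ => (x : ℂ) ^ s) (ψ := fun x : ℝ => (x : ℂ) ^ (-s))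
      (by fun_prop) (by fun_prop)
  refine ⟨(integrable_congr (cpow_div_ae hX hY s)).2 (hind.integrable_mul h1.1 h2.1), ?_⟩
  rw [cmoment, integral_congr_ae (cpow_div_ae hX hY s),
    hind.integral_fun_mul_eq_mul_integral h1.1.aestronglyMeasurable h2.1.aestronglyMeasurable]
  exact congrArg₂ _ h1.2 h2.2

lemma not_ae_eq_zero_rpow [NeZero μ] (hX : ∀ᵐ ω ∂μ, 0 < X ω) (s : ℝ) :
    ¬ (fun ω => X ω ^ s) =ᵐ[μ] 0 := fun h => by
  obtain ⟨ω, h1, h2⟩ := (hX.and h).exists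
  exact (Real.rpow_pos_of_pos h1 s).ne' h2

/-- For independent factors, integrability of the product passes to each factor as soon as the other
is not a.e. zero; powers of positive variables never vanish. This is what shows that the moment
strips of quotients are maximal. -/
lemma integrable_rpow_left_of_div [NeZero μ] {s : ℝ} (hXm : AEMeasurable X μ)
    (hYm : AEMeasurable Y μ) (hX : ∀ᵐ ω ∂μ, 0 < X ω) (hY : ∀ᵐ ω ∂μ, 0 < Y ω)
    (hXY : IndepFun X Y μ) (h : Integrable (fun ω => (X ω / Y ω) ^ s) μ) :
    Integrable (fun ω => X ω ^ s) μ ∧ Integrable (fun ω => Y ω ^ (-s)) μ := by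
  have hind : IndepFun (fun ω => X ω ^ s) (fun ω => Y ω ^ (-s)) μ :=
    hXY.comp (φ := fun x : ℝ => x ^ s) (ψ := fun x : ℝ => x ^ (-s)) (by fun_prop) (by fun_prop)
  have h' := (integrable_congr (rpow_div_ae hX hY s)).1 h
  have m1 : AEStronglyMeasurable (fun ω => X ω ^ s) μ := (hXm.pow_const s).aestronglyMeasurable
  have m2 : AEStronglyMeasurable (fun ω => Y ω ^ (-s)) μ :=
    (hYm.pow_const (-s)).aestronglyMeasurable
  refine ⟨?_, ?_⟩
  · exact hind.integrable_left_of_integrable_op (· * ·) 1 one_ne_zero (by simp) h' m1 m2 (not_ae_eq_zero_rpow hY _)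
  · exact hind.integrable_right_of_integrable_op (· * ·) 1 one_ne_zero (by simp) h' m1 m2 (not_ae_eq_zero_rpow hX _)

lemma HasMoment.rpow {s v : ℂ} (hX : ∀ᵐ ω ∂μ, 0 < X ω) {p : ℝ} (h : HasMoment μ X (p * s) v) :
    HasMoment μ (fun ω => X ω ^ p) s v := by
  have e : ∀ᵐ ω ∂μ, ((X ω ^ p : ℝ) : ℂ) ^ s = (X ω : ℂ) ^ (p * s) := by
    filter_upwards [hX] with ω hω
    rw [ofReal_cpow_eq_exp (Real.rpow_pos_of_pos hω p), ofReal_cpow_eq_exp hω, Real.log_rpow hω]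
    push_cast
    ring_nf
  exact ⟨(integrable_congr e).2 h.1, (integral_congr_ae e).trans h.2⟩

lemma integrable_rpow_rpow_iff (hX : ∀ᵐ ω ∂μ, 0 < X ω) (p s : ℝ) :
    Integrable (fun ω => (X ω ^ p) ^ s) μ ↔ Integrable (fun ω => X ω ^ (p * s)) μ := by
  refine integrable_congr ?_
  filter_upwards [hX] with ω hω
  exact (Real.rpow_mul hω.le p s).symm

lemma HasMoment.integrable_rpow {s v : ℂ} (hm : AEMeasurable X μ) (hX : ∀ᵐ ω ∂μ, 0 < X ω)
    (h : HasMoment μ X s v) : Integrable (fun ω => X ω ^ s.re) μ :=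
  (integrable_cpow_iff hm hX s).1 h.1

lemma rhoPlus_eq {a b : ℝ} (hba : b < a)
    (h1 : ∀ s : ℝ, b < s → s < a → Integrable (fun ω => X ω ^ s) μ)
    (h2 : ∀ s : ℝ, Integrable (fun ω => X ω ^ s) μ → s < a) : rhoPlus μ X = (a : EReal) := by
  refine le_antisymm (sSup_le ?_) (le_of_forall_lt fun c hc => ?_)
  · rintro _ ⟨s, hs, rfl⟩
    exact EReal.coe_le_coe_iff.2 (h2 s hs).le
  -- Staying above `b` as well as `c` keeps `s` in the interval where `h1` applies.
  · obtain ⟨s, hs1, hs2⟩ := EReal.lt_iff_exists_real_btwn.1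
      (max_lt hc (EReal.coe_lt_coe_iff.2 hba))
    refine lt_of_lt_of_le ((le_max_left _ _).trans_lt hs1) (le_sSup ⟨s, h1 s ?_ ?_, rfl⟩)
    · exact_mod_cast (le_max_right _ _).trans_lt hs1
    · exact_mod_cast hs2

lemma rhoMinus_eq {a b : ℝ} (hab : a < b)
    (h1 : ∀ s : ℝ, a < s → s < b → Integrable (fun ω => X ω ^ s) μ)
    (h2 : ∀ s : ℝ, Integrable (fun ω => X ω ^ s) μ → a < s) : rhoMinus μ X = (a : EReal) := by
  refine le_antisymm (le_of_forall_gt fun c hc => ?_) (le_sInf ?_)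
  · obtain ⟨s, hs1, hs2⟩ := EReal.lt_iff_exists_real_btwn.1
      (lt_min hc (EReal.coe_lt_coe_iff.2 hab))
    refine lt_of_le_of_lt (sInf_le ⟨s, h1 s ?_ ?_, rfl⟩) (hs2.trans_le (min_le_left _ _))
    · exact_mod_cast hs1
    · exact_mod_cast hs2.trans_le (min_le_right _ _)
  · rintro _ ⟨s, hs, rfl⟩
    exact EReal.coe_le_coe_iff.2 (h2 s hs).le

end Toolkit

/-! ### The positive stable law: Mellin transform and critical exponent -/

section Stable

variable {Ω : Type*} [MeasurableSpace Ω] {μ : Measure Ω} {X : Ω → ℝ} {α : ℝ}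

lemma integrable_of_lintegral_rpow_lt_top (hm : AEMeasurable X μ) (hX : ∀ᵐ ω ∂μ, 0 < X ω) {s : ℝ}
    (h : ∫⁻ ω, ENNReal.ofReal (X ω ^ s) ∂μ < ⊤) : Integrable (fun ω => X ω ^ s) μ := by
  refine ⟨(hm.pow_const s).aestronglyMeasurable, ?_⟩
  rw [hasFiniteIntegral_iff_ofReal]
  · exact h
  · filter_upwards [hX] with ω hω using (Real.rpow_pos_of_pos hω s).le

lemma integrable_exp_neg_mul [IsFiniteMeasure μ] (hm : AEMeasurable X μ) (hX : ∀ᵐ ω ∂μ, 0 < X ω)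
    {t : ℝ} (ht : 0 < t) : Integrable (fun ω => Real.exp (-t * X ω)) μ := by
  refine Integrable.of_bound (Real.measurable_exp.comp_aemeasurable
    (hm.const_mul (-t))).aestronglyMeasurable 1 ?_
  filter_upwards [hX] with ω hω
  rw [Real.norm_eq_abs, abs_of_pos (Real.exp_pos _), Real.exp_le_one_iff]
  nlinarith

lemma lintegral_rpow_mul_exp_neg_mul {p x : ℝ} (hp : 0 < p) (hx : 0 < x) :
    ∫⁻ t in Set.Ioi (0 : ℝ), ENNReal.ofReal (t ^ (p - 1) * Real.exp (-t * x)) =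
      ENNReal.ofReal (x ^ (-p) * Real.Gamma p) := by
  have h := Real.integral_rpow_mul_exp_neg_mul_Ioi hp hx
  have hi : IntegrableOn (fun t : ℝ => t ^ (p - 1) * Real.exp (-(x * t))) (Set.Ioi 0) := by
    have := integrableOn_rpow_mul_exp_neg_mul_rpow (s := p - 1) (p := 1) (b := x)
      (by linarith) one_pos hx
    simpa using this
  rw [Real.rpow_neg hx.le, ← Real.inv_rpow hx.le, ← one_div, ← h,
    ofReal_integral_eq_lintegral_ofReal hi]
  · refine lintegral_congr fun t => ?_
    ring_nf
  · filter_upwards [self_mem_ae_restrict measurableSet_Ioi] with t ht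
    exact mul_nonneg (Real.rpow_nonneg (le_of_lt ht) _) (Real.exp_pos _).le

namespace IsPositiveStable

variable [IsProbabilityMeasure μ] (h : IsPositiveStable α X μ)
include h

/-- Replace Γ(p) x^(-p) by Euler's integral, swap by Tonelli, insert the Laplace transform, and
evaluate ∫ t^(p-1) exp(-t^α) dt = Γ(p/α)/α. Working with the lower integral yields finiteness
together with the value. -/
lemma lintegral_rpow_neg (hα : 0 < α) {p : ℝ} (hp : 0 < p) :
    ∫⁻ ω, ENNReal.ofReal (X ω ^ (-p)) ∂μ =
      ENNReal.ofReal (Real.Gamma (1 + p / α) / Real.Gamma (1 + p)) := by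
  have hΓ := Real.Gamma_pos_of_pos hp
  have e1 : ∫⁻ ω, ENNReal.ofReal (X ω ^ (-p)) * ENNReal.ofReal (Real.Gamma p) ∂μ =
      ∫⁻ ω, (∫⁻ t in Set.Ioi (0 : ℝ), ENNReal.ofReal (t ^ (p - 1) * Real.exp (-t * X ω))) ∂μ := by
    refine lintegral_congr_ae ?_
    filter_upwards [h.pos] with ω hω
    rw [lintegral_rpow_mul_exp_neg_mul hp hω,
      ENNReal.ofReal_mul (Real.rpow_pos_of_pos hω _).le]
  have e2 : ∫⁻ ω, (∫⁻ t in Set.Ioi (0 : ℝ), ENNReal.ofReal (t ^ (p - 1) * Real.exp (-t * X ω))) ∂μ =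
      ∫⁻ t in Set.Ioi (0 : ℝ), ∫⁻ ω, ENNReal.ofReal (t ^ (p - 1) * Real.exp (-t * X ω)) ∂μ := by
    refine lintegral_lintegral_swap ?_
    have hm := h.aemeasurable.comp_fst (ν := volume.restrict (Set.Ioi (0 : ℝ)))
    refine ENNReal.measurable_ofReal.comp_aemeasurable ?_
    refine AEMeasurable.mul (by fun_prop) (Real.measurable_exp.comp_aemeasurable ?_)
    exact AEMeasurable.mul (by fun_prop) hm
  have e3 : ∫⁻ t in Set.Ioi (0 : ℝ), ∫⁻ ω, ENNReal.ofReal (t ^ (p - 1) * Real.exp (-t * X ω)) ∂μ =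
      ∫⁻ t in Set.Ioi (0 : ℝ), ENNReal.ofReal (t ^ (p - 1) * Real.exp (-t ^ α)) := by
    refine setLIntegral_congr_fun measurableSet_Ioi fun t ht => ?_
    have ht0 : (0 : ℝ) < t := ht
    rw [← h.laplace t ht0, ← integral_const_mul,
      ofReal_integral_eq_lintegral_ofReal
        ((integrable_exp_neg_mul h.aemeasurable h.pos ht0).const_mul _)]
    exact Filter.Eventually.of_forall fun ω =>
      mul_nonneg (Real.rpow_nonneg ht0.le _) (Real.exp_pos _).le
  have e4 : ∫⁻ t in Set.Ioi (0 : ℝ), ENNReal.ofReal (t ^ (p - 1) * Real.exp (-t ^ α)) =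
      ENNReal.ofReal ((1 / α) * Real.Gamma (p / α)) := by
    have := integral_rpow_mul_exp_neg_rpow (q := p - 1) hα (by linarith)
    rw [sub_add_cancel] at this
    rw [← this, ofReal_integral_eq_lintegral_ofReal
      (integrableOn_rpow_mul_exp_neg_rpow (by linarith) hα)]
    filter_upwards [self_mem_ae_restrict measurableSet_Ioi] with t ht
    exact mul_nonneg (Real.rpow_nonneg (le_of_lt ht) _) (Real.exp_pos _).le
  rw [lintegral_mul_const' _ _ ENNReal.ofReal_ne_top, e2, e3, e4] at e1
  have e5 : Real.Gamma (1 + p / α) / Real.Gamma (1 + p) =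
      ((1 / α) * Real.Gamma (p / α)) / Real.Gamma p := by
    rw [add_comm 1, add_comm 1, Real.Gamma_add_one (by positivity), Real.Gamma_add_one hp.ne']
    field_simp
  rw [e5, ENNReal.ofReal_div_of_pos hΓ, ← e1,
    ENNReal.mul_div_cancel_right (by simpa using hΓ) ENNReal.ofReal_ne_top]

lemma integrable_rpow_neg (hα : 0 < α) {p : ℝ} (hp : 0 < p) :
    Integrable (fun ω => X ω ^ (-p)) μ :=
  integrable_of_lintegral_rpow_lt_top h.aemeasurable h.pos
    (by rw [h.lintegral_rpow_neg hα hp]; exact ENNReal.ofReal_lt_top)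

lemma integral_rpow_neg (hα : 0 < α) {p : ℝ} (hp : 0 < p) :
    ∫ ω, X ω ^ (-p) ∂μ = Real.Gamma (1 + p / α) / Real.Gamma (1 + p) := by
  rw [integral_eq_lintegral_of_nonneg_ae _ (h.aemeasurable.pow_const _).aestronglyMeasurable,
    h.lintegral_rpow_neg hα hp, ENNReal.toReal_ofReal]
  · exact div_nonneg (Real.Gamma_pos_of_pos (by positivity)).le
      (Real.Gamma_pos_of_pos (by positivity)).le
  · filter_upwards [h.pos] with ω hω using (Real.rpow_pos_of_pos hω _).le

/-- Markov's inequality for 1 - exp(-X/t): this is at least 1 - e^(-1) where X ≥ t, and its mean 1 -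
exp(-t^(-α)) is at most t^(-α). -/
lemma tail_bound {t : ℝ} (ht : 0 < t) :
    μ {ω | t ≤ X ω} ≤ ENNReal.ofReal ((1 - Real.exp (-1))⁻¹ * t ^ (-α)) := by
  have hc : 0 < 1 - Real.exp (-1) := by
    rw [sub_pos, Real.exp_lt_one_iff]; norm_num
  have hi := integrable_exp_neg_mul h.aemeasurable h.pos (inv_pos.2 ht)
  have hm := mul_meas_ge_le_integral_of_nonneg (μ := μ)
    (f := fun ω => 1 - Real.exp (-t⁻¹ * X ω)) (by
      filter_upwards [h.pos] with ω hω
      simp only [Pi.zero_apply, sub_nonneg, Real.exp_le_one_iff]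
      have := inv_pos.2 ht
      nlinarith) ((integrable_const 1).sub hi) (1 - Real.exp (-1))
  rw [integral_sub (integrable_const 1) hi, h.laplace _ (inv_pos.2 ht)] at hm
  have h1 : 1 - Real.exp (-t⁻¹ ^ α) ≤ t ^ (-α) := by
    have := Real.add_one_le_exp (-t⁻¹ ^ α)
    rw [Real.rpow_neg ht.le, ← Real.inv_rpow ht.le]
    linarith
  have h2 : μ.real {ω | t ≤ X ω} ≤ μ.real {x | 1 - Real.exp (-1) ≤ 1 - Real.exp (-t⁻¹ * X x)} := by
    refine measureReal_mono fun ω (hω : t ≤ X ω) => ?_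
    have : 1 ≤ t⁻¹ * X ω := by
      rw [inv_mul_eq_div, one_le_div ht]; exact hω
    simp only [Set.mem_ofPred_eq, sub_le_sub_iff_left, Real.exp_le_exp]
    linarith
  rw [← ofReal_measureReal]
  refine ENNReal.ofReal_le_ofReal (h2.trans ?_)
  rw [← div_eq_inv_mul, le_div_iff₀ hc, mul_comm]
  refine hm.trans ?_
  simpa using h1

/-- Layer-cake formula split at t = 1: below, the tail is at most 1 and t^(s-1) is integrable as s >
0; above, the tail bound leaves t^(s-1-α), integrable as s < α. -/
lemma integrable_rpow_pos {s : ℝ} (hs : 0 < s) (hsα : s < α) :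
    Integrable (fun ω => X ω ^ s) μ := by
  refine integrable_of_lintegral_rpow_lt_top h.aemeasurable h.pos ?_
  rw [lintegral_rpow_eq_lintegral_meas_le_mul μ (h.pos.mono fun ω hω => hω.le) h.aemeasurable hs]
  refine ENNReal.mul_lt_top ENNReal.ofReal_lt_top ?_
  rw [← Set.Ioo_union_Ici_eq_Ioi (zero_lt_one' ℝ)]
  refine (lintegral_union_le _ _ _).trans_lt (ENNReal.add_lt_top.2 ⟨?_, ?_⟩)
  · refine lt_of_le_of_lt (setLIntegral_mono' (g := fun t => ENNReal.ofReal (t ^ (s - 1)))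
      measurableSet_Ioo fun t _ => ?_) ?_
    · exact mul_le_of_le_one_left' prob_le_one
    · exact ((intervalIntegral.integrableOn_Ioo_rpow_iff one_pos).2
        (by linarith)).lintegral_lt_top
  · refine lt_of_le_of_lt (setLIntegral_mono'
      (g := fun t => ENNReal.ofReal ((1 - Real.exp (-1))⁻¹ * t ^ (s - 1 - α)))
      measurableSet_Ici fun t ht => ?_) ?_
    · have ht0 : (0 : ℝ) < t := lt_of_lt_of_le one_pos ht
      refine (mul_le_mul_left (h.tail_bound ht0) _).trans ?_
      rw [← ENNReal.ofReal_mul' (Real.rpow_nonneg ht0.le _), mul_assoc, ← Real.rpow_add ht0]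
      ring_nf
      exact le_rfl
    · rw [setLIntegral_congr Ioi_ae_eq_Ici.symm]
      exact ((integrableOn_Ioi_rpow_of_lt (by linarith) one_pos).const_mul _).lintegral_lt_top

lemma integrable_rpow (hα : 0 < α) {s : ℝ} (hs : s < α) : Integrable (fun ω => X ω ^ s) μ := by
  rcases lt_trichotomy s 0 with h0 | rfl | h0
  · simpa using h.integrable_rpow_neg hα (neg_pos.2 h0)
  · simp
  · exact h.integrable_rpow_pos h0 hs

/-- The Mellin transform of the positive stable law. -/
lemma hasMoment (hα : 0 < α) {s : ℂ} (hs : s.re < α) :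
    HasMoment μ X s (Complex.Gamma (1 - s / α) / Complex.Gamma (1 - s)) := by
  refine hasMoment_of_real (f := fun s => Complex.Gamma (1 - s / α) / Complex.Gamma (1 - s))
    h.aemeasurable h.pos (I := Set.Iio α) isOpen_Iio Set.ordConnected_Iio
    (fun s hs => h.integrable_rpow hα hs) ?_ (c := -1) (d := 0) (by norm_num)
    (fun x hx => lt_trans hx.2 hα) ?_ hs
  · intro z hz
    have hz' : z.re < α := hz
    have hd : DifferentiableAt ℂ (fun s : ℂ => Complex.Gamma (1 - s / α)) z := by
      refine DifferentiableAt.comp z (g := Complex.Gamma) (Complex.differentiableAt_Gamma _ ?_)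
        (by fun_prop)
      intro m hm
      have := congrArg Complex.re hm
      simp only [Complex.sub_re, Complex.one_re, Complex.div_ofReal_re, Complex.neg_re,
        Complex.natCast_re] at this
      have h1 : z.re / α < 1 := (div_lt_one hα).2 hz'
      have h2 : (0 : ℝ) ≤ m := Nat.cast_nonneg m
      linarith
    -- 1/Γ is entire, so the denominator imposes no restriction on `z`.
    have hd' : DifferentiableAt ℂ (fun s : ℂ => (Complex.Gamma (1 - s))⁻¹) z :=
      DifferentiableAt.comp z (g := fun s => (Complex.Gamma s)⁻¹)
        (Complex.differentiable_one_div_Gamma _) (by fun_prop)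
    simp only [div_eq_mul_inv (Complex.Gamma _)]
    exact (hd.mul hd').differentiableWithinAt
  · intro r _ hr
    have := h.integral_rpow_neg hα (neg_pos.2 hr)
    rw [neg_neg] at this
    rw [this, Complex.ofReal_div, ← Complex.Gamma_ofReal, ← Complex.Gamma_ofReal]
    push_cast
    ring_nf

lemma integral_rpow (hα : 0 < α) {s : ℝ} (hs : s < α) :
    ∫ ω, X ω ^ s ∂μ = Real.Gamma (1 - s / α) / Real.Gamma (1 - s) := by
  have := (h.hasMoment hα (s := s) (by simpa using hs)).2
  rw [cmoment_ofReal h.pos] at this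
  apply Complex.ofReal_injective
  rw [this, Complex.ofReal_div, ← Complex.Gamma_ofReal, ← Complex.Gamma_ofReal]
  push_cast
  rfl

/-- If E X^s were finite with s ≥ α, then X^r ≤ 1 + X^s would bound E X^r uniformly for 0 < r < α.
After multiplication by 1 - r/α, which removes the pole of Γ(1 - r/α), letting r ↑ α gives Γ(1) ≤ 0.
Here α < 1 keeps Γ(1 - r) continuous at r = α. -/
lemma lt_of_integrable_rpow (hα : 0 < α) (hα1 : α < 1) {s : ℝ}
    (hs : Integrable (fun ω => X ω ^ s) μ) : s < α := by
  by_contra! hsα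
  set B := ∫ ω, (1 + X ω ^ s) ∂μ with hB
  have hbound : ∀ r : ℝ, 0 < r → r < α →
      Real.Gamma (2 - r / α) ≤ (1 - r / α) * (B * Real.Gamma (1 - r)) := by
    intro r h0 hr
    have hle : ∫ ω, X ω ^ r ∂μ ≤ B := by
      refine integral_mono_ae (h.integrable_rpow hα hr) ((integrable_const 1).add hs) ?_
      filter_upwards [h.pos] with ω hω
      rcases le_total (X ω) 1 with h1 | h1
      · have := Real.rpow_le_one hω.le h1 h0.le
        have := Real.rpow_pos_of_pos hω s
        linarith
      · have := Real.rpow_le_rpow_of_exponent_le h1 (hr.le.trans hsα)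
        linarith
    have hr1 : 0 < 1 - r / α := by rw [sub_pos, div_lt_one hα]; exact hr
    rw [h.integral_rpow hα hr, div_le_iff₀ (Real.Gamma_pos_of_pos (by linarith))] at hle
    have := Real.Gamma_add_one hr1.ne'
    rw [show (2 : ℝ) - r / α = 1 - r / α + 1 by ring, this]
    gcongr
  have hc1 : ContinuousAt (fun r : ℝ => Real.Gamma (2 - r / α)) α := by
    refine ContinuousAt.comp (g := Real.Gamma) ?_ (by fun_prop)
    refine (Real.differentiableAt_Gamma fun m hm => ?_).continuousAt
    rw [div_self hα.ne'] at hm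
    have : (0 : ℝ) ≤ m := Nat.cast_nonneg m
    linarith
  have hc2 : ContinuousAt (fun r : ℝ => (1 - r / α) * (B * Real.Gamma (1 - r))) α := by
    have : ContinuousAt (fun r : ℝ => Real.Gamma (1 - r)) α := by
      refine ContinuousAt.comp (g := Real.Gamma) ?_ (by fun_prop)
      refine (Real.differentiableAt_Gamma fun m hm => ?_).continuousAt
      have : (0 : ℝ) ≤ m := Nat.cast_nonneg m
      linarith
    fun_prop
  have hlim := le_of_tendsto_of_tendsto (b := nhdsWithin α (Set.Iio α))
    (hc1.tendsto.mono_left nhdsWithin_le_nhds) (hc2.tendsto.mono_left nhdsWithin_le_nhds) (by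
      filter_upwards [nhdsWithin_le_nhds (Ioi_mem_nhds hα), self_mem_nhdsWithin] with r h1 h2
      exact hbound r h1 h2)
  rw [div_self hα.ne', sub_self, zero_mul, show (2 : ℝ) - 1 = 1 by norm_num,
    Real.Gamma_one] at hlim
  linarith

end IsPositiveStable
end Stable

/-! ### Mellin transform of 1 / (x² + 2x cos θ + 1) -/

section CauchyKernel

lemma integrableOn_rpow_mul_exp_neg_mul {a r : ℝ} (ha : 0 < a) (hr : 0 < r) :
    IntegrableOn (fun x : ℝ => x ^ (a - 1) * Real.exp (-(r * x))) (Set.Ioi 0) := by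
  simpa using integrableOn_rpow_mul_exp_neg_mul_rpow (s := a - 1) (p := 1) (b := r)
    (by linarith) one_pos hr

/-- Euler's integral with a complex rate in the right half-plane. -/
lemma integral_rpow_mul_cexp_neg_mul_Ioi {a : ℝ} (ha : 0 < a) {r : ℂ} (hr : 0 < r.re) :
    ∫ x in Set.Ioi (0 : ℝ), ((x ^ (a - 1) : ℝ) : ℂ) * Complex.exp (-(r * x)) =
      Real.Gamma a * r ^ (-a : ℂ) := by
  -- With x^(a-1) absorbed into the measure, the integral is the complex moment generating function
  -- of the identity at z = -r, hence holomorphic for Re z < 0. The real Euler integral then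
  -- determines it.
  set w : ℝ → ENNReal := fun x => ENNReal.ofReal (x ^ (a - 1)) with hw
  have hwm : Measurable w := by fun_prop
  have hwt : ∀ᵐ x ∂(volume.restrict (Set.Ioi (0 : ℝ))), w x < ⊤ :=
    Filter.Eventually.of_forall fun _ => ENNReal.ofReal_lt_top
  set ν := (volume.restrict (Set.Ioi (0 : ℝ))).withDensity w with hν
  have hMGF : ∀ z : ℂ, complexMGF id ν z =
      ∫ x in Set.Ioi (0 : ℝ), ((x ^ (a - 1) : ℝ) : ℂ) * Complex.exp (z * x) := by
    intro z
    rw [complexMGF, integral_withDensity_eq_integral_toReal_smul hwm hwt]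
    refine setIntegral_congr_fun measurableSet_Ioi fun x hx => ?_
    simp only [hw, id]
    rw [ENNReal.toReal_ofReal (Real.rpow_nonneg (le_of_lt hx) _), Complex.real_smul]
  have hmem : ∀ s ∈ Set.Iio (0 : ℝ), s ∈ integrableExpSet id ν := by
    intro s hs
    refine (integrable_withDensity_iff_integrable_smul' hwm hwt).2 ?_
    refine (integrableOn_rpow_mul_exp_neg_mul ha (neg_pos.2 hs)).congr_fun (fun x hx => ?_)
      measurableSet_Ioi
    simp only [hw, id]
    rw [ENNReal.toReal_ofReal (Real.rpow_nonneg (le_of_lt hx) _), smul_eq_mul, neg_mul, neg_neg]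
  have hd : DifferentiableOn ℂ (complexMGF id ν) (Complex.re ⁻¹' Set.Iio 0) :=
    differentiableOn_complexMGF.mono fun z hz => interior_maximal hmem isOpen_Iio hz
  have hd' : DifferentiableOn ℂ (fun z : ℂ => Real.Gamma a * (-z) ^ (-a : ℂ))
      (Complex.re ⁻¹' Set.Iio 0) := by
    intro z hz
    have hz0 : z.re < 0 := hz
    refine ((differentiableAt_const _).mul (DifferentiableAt.cpow (by fun_prop) (by fun_prop)
      (Or.inl ?_))).differentiableWithinAt
    simpa using hz0
  have key := eqOn_strip_of_eq_real isOpen_Iio Set.ordConnected_Iio hd hd'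
    (c := -1) (d := 0) (by norm_num) (fun x hx => hx.2) (fun s _ hs => by
      have hs' : 0 < -s := neg_pos.2 hs
      have h := Real.integral_rpow_mul_exp_neg_mul_Ioi ha hs'
      rw [complexMGF_ofReal, ← Complex.ofReal_neg, ← Complex.ofReal_neg,
        ← Complex.ofReal_cpow hs'.le, ← Complex.ofReal_mul, Real.rpow_neg hs'.le,
        ← Real.inv_rpow hs'.le, ← one_div, mul_comm (Real.Gamma a), ← h, mgf,
        integral_withDensity_eq_integral_toReal_smul hwm hwt]
      congr 1
      refine setIntegral_congr_fun measurableSet_Ioi fun x hx => ?_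
      simp only [hw, id]
      rw [ENNReal.toReal_ofReal (Real.rpow_nonneg (le_of_lt hx) _), smul_eq_mul, neg_mul, neg_neg])
  have := key (x := -r) (by simpa using hr)
  rw [hMGF] at this
  simpa using this

lemma ofReal_mul_cpow {u : ℝ} (hu : 0 < u) {r : ℂ} (hr : r ≠ 0) (b : ℂ) :
    ((u : ℂ) * r) ^ b = (u : ℂ) ^ b * r ^ b := by
  have hu' : (u : ℂ) ≠ 0 := by exact_mod_cast hu.ne'
  rw [Complex.cpow_def_of_ne_zero (mul_ne_zero hu' hr), Complex.cpow_def_of_ne_zero hu',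
    Complex.cpow_def_of_ne_zero hr, Complex.log_ofReal_mul hu hr, Complex.ofReal_log hu.le,
    add_mul, Complex.exp_add]

/-- The Mellin transform of `1 / (r x + q)` for `r`, `q` in the right half-plane. -/
lemma integral_rpow_div_linear {a : ℝ} (ha : 0 < a) (ha1 : a < 1) {r q : ℂ} (hr : 0 < r.re)
    (hq : 0 < q.re) :
    IntegrableOn (fun x : ℝ => ((x ^ (a - 1) : ℝ) : ℂ) / (r * x + q)) (Set.Ioi 0) ∧
    ∫ x in Set.Ioi (0 : ℝ), ((x ^ (a - 1) : ℝ) : ℂ) / (r * x + q) =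
      Real.Gamma a * Real.Gamma (1 - a) * (r ^ (-a : ℂ) * q ^ (a - 1 : ℂ)) := by
  have hr0 : r ≠ 0 := fun h => by simp [h] at hr
  -- Write 1/(rx + q) = ∫ exp(-(rx + q)u) du and apply Fubini: the x-integral gives Γ(a) (ur)^(-a),
  -- and the remaining u-integral gives Γ(1-a) q^(a-1).
  set F : ℝ → ℝ → ℂ := fun x u =>
    ((x ^ (a - 1) : ℝ) : ℂ) * Complex.exp (-((r * x + q) * u)) with hF
  set m := volume.restrict (Set.Ioi (0 : ℝ)) with hm
  have hnorm : ∀ u ∈ Set.Ioi (0 : ℝ), ∀ x ∈ Set.Ioi (0 : ℝ),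
      ‖F x u‖ = Real.exp (-(q.re * u)) * (x ^ (a - 1) * Real.exp (-((u * r.re) * x))) := by
    intro u _ x hx
    have hx0 : (0 : ℝ) < x := hx
    simp only [hF]
    rw [norm_mul, Complex.norm_real, Real.norm_of_nonneg (Real.rpow_nonneg hx0.le _),
      Complex.norm_exp, mul_left_comm, ← Real.exp_add]
    congr 2
    simp
    ring
  have hFi : Integrable (Function.uncurry F) (m.prod m) := by
    refine (integrable_prod_iff' ?_).2 ⟨?_, ?_⟩
    · refine Measurable.aestronglyMeasurable ?_
      simp only [hF, Function.uncurry_def]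
      fun_prop
    · filter_upwards [self_mem_ae_restrict measurableSet_Ioi] with u hu
      have hu0 : (0 : ℝ) < u := hu
      have hmeas : AEStronglyMeasurable (fun x => F x u) m := by
        refine Measurable.aestronglyMeasurable ?_
        simp only [hF]
        fun_prop
      refine (integrable_norm_iff hmeas).1 (IntegrableOn.congr_fun
        ((integrableOn_rpow_mul_exp_neg_mul ha (mul_pos hu0 hr)).const_mul
          (Real.exp (-(q.re * u)))) (fun x hx => (hnorm u hu x hx).symm) measurableSet_Ioi)
    · have : IntegrableOn (fun u : ℝ => ((1 / r.re) ^ a * Real.Gamma a) *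
          (u ^ ((1 - a) - 1) * Real.exp (-(q.re * u)))) (Set.Ioi 0) :=
        (integrableOn_rpow_mul_exp_neg_mul (by linarith) hq).const_mul _
      refine this.congr_fun (fun u hu => ?_) measurableSet_Ioi
      have hu0 : (0 : ℝ) < u := hu
      simp only [Function.uncurry]
      rw [setIntegral_congr_fun measurableSet_Ioi (hnorm u hu), integral_const_mul,
        Real.integral_rpow_mul_exp_neg_mul_Ioi ha (mul_pos hu0 hr), one_div, one_div,
        mul_inv, Real.mul_rpow (inv_pos.2 hu0).le (inv_pos.2 hr).le, Real.inv_rpow hu0.le,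
        ← Real.rpow_neg hu0.le, show 1 - a - 1 = -a by ring]
      ring
  have hinner : ∀ x ∈ Set.Ioi (0 : ℝ),
      ∫ u, F x u ∂m = ((x ^ (a - 1) : ℝ) : ℂ) / (r * x + q) := by
    intro x hx
    have hx0 : (0 : ℝ) < x := hx
    have hre : (-(r * x + q)).re < 0 := by
      have := mul_pos hr hx0
      simp
      linarith
    have h := integral_exp_mul_complex_Ioi hre 0
    simp only [hF]
    rw [integral_const_mul]
    simp only [← neg_mul]
    rw [h]
    rw [Complex.ofReal_zero, mul_zero, Complex.exp_zero, neg_div_neg_eq, mul_one_div]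
  refine ⟨?_, ?_⟩
  · refine IntegrableOn.congr_fun (f := fun x => ∫ u, F x u ∂m) ?_ hinner measurableSet_Ioi
    exact hFi.integral_prod_left
  · rw [← setIntegral_congr_fun measurableSet_Ioi hinner, ← hm, integral_integral_swap hFi]
    have h1 : ∀ u ∈ Set.Ioi (0 : ℝ), ∫ x, F x u ∂m =
        (Real.Gamma a * r ^ (-a : ℂ)) *
          (((u ^ ((1 - a) - 1) : ℝ) : ℂ) * Complex.exp (-(q * u))) := by
      intro u hu
      have hu0 : (0 : ℝ) < u := hu
      have hre : 0 < ((u : ℂ) * r).re := by simpa using mul_pos hu0 hr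
      have h := integral_rpow_mul_cexp_neg_mul_Ioi ha hre
      rw [ofReal_mul_cpow hu0 hr0] at h
      have e : ∀ x : ℝ, F x u = Complex.exp (-(q * u)) *
          (((x ^ (a - 1) : ℝ) : ℂ) * Complex.exp (-(u * r * x))) := by
        intro x
        simp only [hF]
        rw [mul_left_comm, ← Complex.exp_add]
        ring_nf
      simp only [e]
      rw [integral_const_mul, h, show 1 - a - 1 = -a by ring, Complex.ofReal_cpow hu0.le]
      push_cast
      ring
    rw [hm, setIntegral_congr_fun measurableSet_Ioi h1, integral_const_mul,
      integral_rpow_mul_cexp_neg_mul_Ioi (by linarith) hq]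
    rw [show (-((1 - a : ℝ) : ℂ)) = (a - 1 : ℂ) by push_cast; ring]
    ring

/-- The quadratic `x² + 2 x cos θ + 1` has no zero on `[0, ∞)` when `0 < θ < π`. -/
lemma cauchyKernel_pos {θ : ℝ} (hθ : 0 < θ) (hθ' : θ < Real.pi) (x : ℝ) :
    0 < x ^ 2 + 2 * Real.cos θ * x + 1 := by
  have h := Real.sin_pos_of_pos_of_lt_pi hθ hθ'
  nlinarith [Real.sin_sq_add_cos_sq θ, sq_nonneg (x + Real.cos θ), mul_pos h h]

/-- Put φ = θ/2, r = e^(-iφ), q = e^(iφ), both in the right half-plane. Then |rx + q|² is the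
quadratic, and the real and imaginary parts of x^(a-1)/(rx + q) are x^(a-1) over the quadratic times
(x+1) cos φ and (x-1) sin φ. Suitable combinations isolate the numerators x^(a-1) and x^a. -/
lemma cauchyKernel_mellin_aux {θ : ℝ} (hθ : 0 < θ) (hθ' : θ < Real.pi) {a : ℝ} (ha : 0 < a)
    (ha1 : a < 1) :
    IntegrableOn (fun x : ℝ => x ^ (a - 1) * (1 / (x ^ 2 + 2 * Real.cos θ * x + 1)))
      (Set.Ioi 0) ∧
    IntegrableOn (fun x : ℝ => x ^ a * (1 / (x ^ 2 + 2 * Real.cos θ * x + 1))) (Set.Ioi 0) ∧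
    ∫ x in Set.Ioi (0 : ℝ), x ^ a * (1 / (x ^ 2 + 2 * Real.cos θ * x + 1)) =
      Real.pi * Real.sin (θ * a) / (Real.sin θ * Real.sin (Real.pi * a)) := by
  set φ := θ / 2 with hφ
  have hθφ : θ = 2 * φ := by rw [hφ]; ring
  have hs : 0 < Real.sin φ := Real.sin_pos_of_pos_of_lt_pi (by linarith) (by linarith)
  have hc : 0 < Real.cos φ := Real.cos_pos_of_mem_Ioo ⟨by linarith, by linarith⟩
  set r := Complex.exp ((-φ : ℝ) * Complex.I) with hr
  set q := Complex.exp ((φ : ℝ) * Complex.I) with hq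
  have hrre : r.re = Real.cos φ := by rw [hr, Complex.exp_ofReal_mul_I_re, Real.cos_neg]
  have hrim : r.im = -Real.sin φ := by rw [hr, Complex.exp_ofReal_mul_I_im, Real.sin_neg]
  have hqre : q.re = Real.cos φ := by rw [hq, Complex.exp_ofReal_mul_I_re]
  have hqim : q.im = Real.sin φ := by rw [hq, Complex.exp_ofReal_mul_I_im]
  obtain ⟨hint, hval⟩ := integral_rpow_div_linear ha ha1 (hrre ▸ hc) (hqre ▸ hc)
  have hpow : r ^ (-a : ℂ) * q ^ (a - 1 : ℂ) =
      Complex.exp ((φ * (2 * a - 1) : ℝ) * Complex.I) := by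
    rw [Complex.cpow_def_of_ne_zero (Complex.exp_ne_zero _),
      Complex.cpow_def_of_ne_zero (Complex.exp_ne_zero _), Complex.log_exp,
      Complex.log_exp, ← Complex.exp_add]
    · push_cast; ring_nf
    all_goals simp
    all_goals linarith
  have hQ := cauchyKernel_pos hθ hθ'
  have hcos : Real.cos θ = Real.cos φ ^ 2 - Real.sin φ ^ 2 := by
    rw [hθφ, Real.cos_two_mul']
  have hnsq : ∀ x : ℝ, Complex.normSq (r * x + q) = x ^ 2 + 2 * Real.cos θ * x + 1 := by
    intro x
    rw [Complex.normSq_apply]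
    simp only [Complex.add_re, Complex.add_im, Complex.re_mul_ofReal, Complex.im_mul_ofReal,
      hrre, hrim, hqre, hqim, hcos]
    linear_combination (x ^ 2 + 1) * Real.sin_sq_add_cos_sq φ
  have hre : ∀ x : ℝ, (((x ^ (a - 1) : ℝ) : ℂ) / (r * x + q)).re =
      Real.cos φ * (x ^ (a - 1) * (x + 1) * (1 / (x ^ 2 + 2 * Real.cos θ * x + 1))) := by
    intro x
    rw [div_eq_mul_inv, Complex.re_ofReal_mul, Complex.inv_re, hnsq]
    simp only [Complex.add_re, Complex.re_mul_ofReal, hrre, hqre]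
    ring
  have him : ∀ x : ℝ, (((x ^ (a - 1) : ℝ) : ℂ) / (r * x + q)).im =
      Real.sin φ * (x ^ (a - 1) * (x - 1) * (1 / (x ^ 2 + 2 * Real.cos θ * x + 1))) := by
    intro x
    rw [div_eq_mul_inv, Complex.im_ofReal_mul, Complex.inv_im, hnsq]
    simp only [Complex.add_im, Complex.im_mul_ofReal, hrim, hqim]
    ring
  have i1 : IntegrableOn (fun x : ℝ => (((x ^ (a - 1) : ℝ) : ℂ) / (r * x + q)).re)
      (Set.Ioi 0) := hint.re
  have i2 : IntegrableOn (fun x : ℝ => (((x ^ (a - 1) : ℝ) : ℂ) / (r * x + q)).im)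
      (Set.Ioi 0) := hint.im
  have v1 : ∫ x in Set.Ioi (0 : ℝ), (((x ^ (a - 1) : ℝ) : ℂ) / (r * x + q)).re =
      Real.Gamma a * Real.Gamma (1 - a) * Real.cos (φ * (2 * a - 1)) := by
    have := integral_re hint
    simp only [RCLike.re_to_complex] at this
    rw [this, hval, hpow, ← Complex.ofReal_mul, Complex.re_ofReal_mul,
      Complex.exp_ofReal_mul_I_re]
  have v2 : ∫ x in Set.Ioi (0 : ℝ), (((x ^ (a - 1) : ℝ) : ℂ) / (r * x + q)).im =
      Real.Gamma a * Real.Gamma (1 - a) * Real.sin (φ * (2 * a - 1)) := by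
    have := integral_im hint
    simp only [RCLike.im_to_complex] at this
    rw [this, hval, hpow, ← Complex.ofReal_mul, Complex.im_ofReal_mul,
      Complex.exp_ofReal_mul_I_im]
  have hmin : ∀ x ∈ Set.Ioi (0 : ℝ),
      (2 * Real.cos φ)⁻¹ * (((x ^ (a - 1) : ℝ) : ℂ) / (r * x + q)).re -
        (2 * Real.sin φ)⁻¹ * (((x ^ (a - 1) : ℝ) : ℂ) / (r * x + q)).im =
      x ^ (a - 1) * (1 / (x ^ 2 + 2 * Real.cos θ * x + 1)) := by
    intro x _
    rw [hre, him]
    have := (hQ x).ne'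
    field_simp
    ring
  have hplus : ∀ x ∈ Set.Ioi (0 : ℝ),
      (2 * Real.cos φ)⁻¹ * (((x ^ (a - 1) : ℝ) : ℂ) / (r * x + q)).re +
        (2 * Real.sin φ)⁻¹ * (((x ^ (a - 1) : ℝ) : ℂ) / (r * x + q)).im =
      x ^ a * (1 / (x ^ 2 + 2 * Real.cos θ * x + 1)) := by
    intro x hx
    have hx0 : (0 : ℝ) < x := hx
    rw [hre, him, show x ^ a = x ^ (a - 1) * x by
      rw [← Real.rpow_add_one hx0.ne', sub_add_cancel]]
    have := (hQ x).ne'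
    field_simp
    ring
  refine ⟨IntegrableOn.congr_fun ((i1.const_mul _).sub (i2.const_mul _)) hmin measurableSet_Ioi,
    IntegrableOn.congr_fun ((i1.const_mul _).add (i2.const_mul _)) hplus measurableSet_Ioi, ?_⟩
  rw [← setIntegral_congr_fun measurableSet_Ioi hplus,
    integral_add (i1.const_mul _) (i2.const_mul _), integral_const_mul, integral_const_mul, v1, v2,
    Real.Gamma_mul_Gamma_one_sub]
  have hsa : 0 < Real.sin (Real.pi * a) :=
    Real.sin_pos_of_pos_of_lt_pi (mul_pos Real.pi_pos ha) (by nlinarith [Real.pi_pos])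
  -- Addition formula for θa = φ + φ(2a - 1).
  have e1 : Real.sin (θ * a) = Real.sin φ * Real.cos (φ * (2 * a - 1)) +
      Real.cos φ * Real.sin (φ * (2 * a - 1)) := by
    rw [← Real.sin_add, hθφ]; ring_nf
  have e2 : Real.sin θ = 2 * Real.sin φ * Real.cos φ := by rw [hθφ, Real.sin_two_mul]
  rw [e1, e2]
  field_simp

lemma integrableOn_cauchyKernel {θ : ℝ} (hθ : 0 < θ) (hθ' : θ < Real.pi) {s : ℝ} (hs : -1 < s)
    (hs1 : s < 1) :
    IntegrableOn (fun x : ℝ => x ^ s * (1 / (x ^ 2 + 2 * Real.cos θ * x + 1))) (Set.Ioi 0) := by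
  rcases lt_trichotomy s 0 with h0 | rfl | h0
  · simpa using (cauchyKernel_mellin_aux hθ hθ' (a := s + 1) (by linarith) (by linarith)).1
  -- The exponent 0 is an excluded endpoint of both families; it is dominated through 1 ≤ x^(-1/2) +
  -- x^(1/2).
  · obtain ⟨h1, h2, -⟩ := cauchyKernel_mellin_aux hθ hθ' (a := 1 / 2) (by norm_num) (by norm_num)
    refine Integrable.mono' (h1.add h2) (Measurable.aestronglyMeasurable (by fun_prop)) ?_
    filter_upwards [self_mem_ae_restrict measurableSet_Ioi] with x hx
    have hx0 : (0 : ℝ) < x := hx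
    have hQ := one_div_pos.2 (cauchyKernel_pos hθ hθ' x)
    rw [Real.norm_of_nonneg (by positivity), Real.rpow_zero, Pi.add_apply, ← add_mul]
    refine mul_le_mul_of_nonneg_right ?_ hQ.le
    rcases le_total x 1 with h | h
    · have := Real.one_le_rpow_of_pos_of_le_one_of_nonpos (z := 1 / 2 - 1) hx0 h (by norm_num)
      have := Real.rpow_nonneg hx0.le (1 / 2 : ℝ)
      linarith
    · have := Real.one_le_rpow (z := 1 / 2) h (by norm_num)
      have := Real.rpow_nonneg hx0.le (1 / 2 - 1 : ℝ)
      linarith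
  · exact (cauchyKernel_mellin_aux hθ hθ' h0 hs1).2.1

lemma integral_cauchyKernel {θ : ℝ} (hθ : 0 < θ) (hθ' : θ < Real.pi) {s : ℝ} (hs : 0 < s)
    (hs1 : s < 1) :
    ∫ x in Set.Ioi (0 : ℝ), x ^ s * (1 / (x ^ 2 + 2 * Real.cos θ * x + 1)) =
      Real.pi * Real.sin (θ * s) / (Real.sin θ * Real.sin (Real.pi * s)) :=
  (cauchyKernel_mellin_aux hθ hθ' hs hs1).2.2

end CauchyKernel

/-! ### Densities identified through moments -/

section Density

variable {Ω : Type*} [MeasurableSpace Ω] {μ : Measure Ω} {X : Ω → ℝ}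

/-- Moment uniqueness, applied to `X` and to the identity under the measure with density `f`. Asking
for equality only when 0 < s < ε avoids s = 0, where the sine formulas degenerate; the total mass of
`f` is then automatic. -/
lemma hasPosDensity_of_rpow_moments [IsFiniteMeasure μ] (hm : AEMeasurable X μ)
    (hX : ∀ᵐ ω ∂μ, 0 < X ω) {f : ℝ → ℝ} (hf : Measurable f) (hf0 : ∀ x, 0 < x → 0 ≤ f x) {ε : ℝ}
    (hε : 0 < ε) (hXi : ∀ s ∈ Set.Ioo (-ε) ε, Integrable (fun ω => X ω ^ s) μ)
    (hfi : ∀ s ∈ Set.Ioo (-ε) ε, IntegrableOn (fun x : ℝ => x ^ s * f x) (Set.Ioi 0))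
    (h : ∀ s : ℝ, 0 < s → s < ε → ∫ ω, X ω ^ s ∂μ = ∫ x in Set.Ioi (0 : ℝ), x ^ s * f x) :
    HasPosDensity μ X f := by
  refine ⟨hm, ?_⟩
  have hfm : Measurable fun x => ENNReal.ofReal (f x) := by fun_prop
  have hft : ∀ᵐ x ∂(volume.restrict (Set.Ioi (0 : ℝ))), ENNReal.ofReal (f x) < ⊤ :=
    Filter.Eventually.of_forall fun _ => ENNReal.ofReal_lt_top
  have hcongr : ∀ s : ℝ, ∀ x ∈ Set.Ioi (0 : ℝ),
      x ^ s * f x = (ENNReal.ofReal (f x)).toReal • x ^ s := fun s x hx => by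
    rw [ENNReal.toReal_ofReal (hf0 x hx), smul_eq_mul, mul_comm]
  have hfin : IsFiniteMeasure
      ((volume.restrict (Set.Ioi (0 : ℝ))).withDensity fun x => ENNReal.ofReal (f x)) := by
    refine isFiniteMeasure_withDensity_ofReal ?_
    have := hfi 0 ⟨by linarith, hε⟩
    simp only [Real.rpow_zero, one_mul] at this
    exact this.2
  have hpos : ∀ᵐ x ∂((volume.restrict (Set.Ioi (0 : ℝ))).withDensity
      fun x => ENNReal.ofReal (f x)), 0 < id x :=
    (withDensity_absolutelyContinuous _ _).ae_le (self_mem_ae_restrict measurableSet_Ioi)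
  rw [map_eq_map_of_rpow_moments hm hX aemeasurable_id hpos hε hXi, Measure.map_id]
  · intro s hs
    exact (integrable_withDensity_iff_integrable_smul' hfm hft).2
      ((hfi s hs).congr_fun (hcongr s) measurableSet_Ioi)
  · intro s h0 h1
    rw [h s h0 h1, integral_withDensity_eq_integral_toReal_smul hfm hft,
      setIntegral_congr_fun measurableSet_Ioi (hcongr s)]
    rfl

end Density

/-! ### The Mittag-Leffler law of `S ^ (-α)`, and the folded Cauchy law -/

section MittagLeffler

/-- Keep only the part t > R of Euler's integral, where t^x ≥ R^x. -/
lemma rpow_mul_exp_neg_le_Gamma {R x : ℝ} (hR : 0 < R) (hx : 0 ≤ x) :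
    R ^ x * Real.exp (-R) ≤ Real.Gamma (1 + x) := by
  have hi : IntegrableOn (fun t : ℝ => Real.exp (-t) * t ^ (1 + x - 1)) (Set.Ioi 0) :=
    Real.GammaIntegral_convergent (by linarith)
  have he : IntegrableOn (fun t : ℝ => R ^ x * Real.exp (-t)) (Set.Ioi R) :=
    (integrableOn_exp_neg_Ioi R).const_mul _
  rw [Real.Gamma_eq_integral (by linarith), ← integral_exp_neg_Ioi R, ← integral_const_mul]
  calc ∫ t in Set.Ioi R, R ^ x * Real.exp (-t)
      ≤ ∫ t in Set.Ioi R, Real.exp (-t) * t ^ (1 + x - 1) := by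
        refine setIntegral_mono_on he (hi.mono_set (Set.Ioi_subset_Ioi hR.le)) measurableSet_Ioi
          fun t ht => ?_
        rw [mul_comm, add_sub_cancel_left]
        exact mul_le_mul_of_nonneg_left (Real.rpow_le_rpow hR.le (le_of_lt ht) hx)
          (Real.exp_pos _).le
    _ ≤ ∫ t in Set.Ioi (0 : ℝ), Real.exp (-t) * t ^ (1 + x - 1) := by
        refine setIntegral_mono_set hi ?_ (Set.Ioi_subset_Ioi hR.le).eventuallyLE
        filter_upwards [self_mem_ae_restrict measurableSet_Ioi] with t ht
        exact mul_nonneg (Real.exp_pos _).le (Real.rpow_nonneg (le_of_lt ht) _)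

lemma summable_pow_div_Gamma {α : ℝ} (hα : 0 < α) {r : ℝ} (hr : 0 ≤ r) :
    Summable fun n : ℕ => r ^ n / Real.Gamma (1 + α * n) := by
  -- Chosen so that R^(αn) = (r+1)^n, which dominates the series by a geometric one of ratio r/(r+1)
  -- < 1.
  set R : ℝ := (r + 1) ^ (1 / α) with hR
  have hR0 : 0 < R := Real.rpow_pos_of_pos (by linarith) _
  have hq0 : 0 ≤ r / (r + 1) := by positivity
  have hq : r / (r + 1) < 1 := by rw [div_lt_one (by linarith)]; linarith
  refine Summable.of_nonneg_of_le (fun n => ?_) (fun n => ?_)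
    ((summable_geometric_of_lt_one hq0 hq).mul_left (Real.exp R))
  · exact div_nonneg (by positivity) (Real.Gamma_pos_of_pos (by positivity)).le
  · have h := rpow_mul_exp_neg_le_Gamma hR0 (x := α * n) (by positivity)
    have e : R ^ (α * n) = (r + 1) ^ n := by
      rw [hR, ← Real.rpow_mul (by linarith), ← mul_assoc, one_div_mul_cancel hα.ne', one_mul,
        Real.rpow_natCast]
    rw [e] at h
    have hpos : 0 < (r + 1) ^ n * Real.exp (-R) := by positivity
    calc r ^ n / Real.Gamma (1 + α * n) ≤ r ^ n / ((r + 1) ^ n * Real.exp (-R)) := by gcongr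
      _ = Real.exp R * (r / (r + 1)) ^ n := by
        rw [Real.exp_neg, div_pow]; field_simp

variable {Ω : Type*} [MeasurableSpace Ω] {μ : Measure Ω} [IsProbabilityMeasure μ]
  {X : Ω → ℝ} {α : ℝ}

/-- The n-th moment of X^(-α) is n!/Γ(1 + αn); the factorials cancel those of the exponential
series. Termwise integration is justified by the same series at |t|. -/
lemma IsPositiveStable.isMittagLeffler (h : IsPositiveStable α X μ) (hα : 0 < α) :
    IsMittagLeffler α (fun ω => X ω ^ (-α)) μ := by
  have hm : AEMeasurable (fun ω => X ω ^ (-α)) μ := h.aemeasurable.pow_const _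
  have hpow : ∀ n : ℕ, ∀ᵐ ω ∂μ, (X ω ^ (-α)) ^ n = X ω ^ (-(α * n)) := fun n => by
    filter_upwards [h.pos] with ω hω
    rw [← Real.rpow_natCast, ← Real.rpow_mul hω.le, neg_mul]
  have hint : ∀ n : ℕ, Integrable (fun ω => (X ω ^ (-α)) ^ n) μ := fun n => by
    refine (integrable_congr (hpow n)).2 (h.integrable_rpow hα ?_)
    have : (0 : ℝ) ≤ α * n := by positivity
    linarith
  have hval : ∀ n : ℕ, ∫ ω, (X ω ^ (-α)) ^ n ∂μ = n.factorial / Real.Gamma (1 + α * n) := by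
    intro n
    have : (0 : ℝ) ≤ α * n := by positivity
    rw [integral_congr_ae (hpow n), h.integral_rpow hα (by linarith), ← Real.Gamma_nat_eq_factorial]
    congr 2 <;> field_simp <;> ring
  have hFint : ∀ (t : ℝ) (n : ℕ),
      Integrable (fun ω => (t * X ω ^ (-α)) ^ n / n.factorial) μ := fun t n => by
    simp only [mul_pow]
    exact ((hint n).const_mul _).div_const _
  have hFval : ∀ (t : ℝ) (n : ℕ), ∫ ω, (t * X ω ^ (-α)) ^ n / n.factorial ∂μ =
      t ^ n / Real.Gamma (1 + α * n) := fun t n => by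
    simp only [mul_pow]
    rw [integral_div, integral_const_mul, hval]
    have : (n.factorial : ℝ) ≠ 0 := by exact_mod_cast n.factorial_ne_zero
    field_simp
  have hnorm : ∀ (t : ℝ) (n : ℕ), ∀ᵐ ω ∂μ, ‖(t * X ω ^ (-α)) ^ n / n.factorial‖ =
      (|t| * X ω ^ (-α)) ^ n / n.factorial := fun t n => by
    filter_upwards [h.pos] with ω hω
    rw [norm_div, norm_pow, norm_mul, Real.norm_eq_abs, Real.norm_natCast,
      Real.norm_of_nonneg (Real.rpow_pos_of_pos hω _).le]
  have hsum : ∀ t : ℝ,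
      Summable fun n : ℕ => ∫ ω, ‖(t * X ω ^ (-α)) ^ n / n.factorial‖ ∂μ := fun t => by
    refine (summable_pow_div_Gamma hα (abs_nonneg t)).congr fun n => ?_
    rw [integral_congr_ae (hnorm t n), hFval]
  have hexp : ∀ (t : ℝ) (ω : Ω), ∑' n : ℕ, (t * X ω ^ (-α)) ^ n / n.factorial =
      Real.exp (t * X ω ^ (-α)) := fun t ω => by
    rw [Real.exp_eq_exp_ℝ, NormedSpace.exp_eq_tsum_div]
  have hpos : ∀ᵐ ω ∂μ, 0 < X ω ^ (-α) := by
    filter_upwards [h.pos] with ω hω using Real.rpow_pos_of_pos hω _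
  have hmgf : ∀ t : ℝ, HasSum (fun n : ℕ => t ^ n / Real.Gamma (1 + α * n))
      (∫ ω, Real.exp (t * X ω ^ (-α)) ∂μ) := fun t => by
    have := hasSum_integral_of_summable_integral_norm (hFint t) (hsum t)
    simpa only [hexp, hFval] using this
  refine ⟨hm, hpos, fun t => ?_, hmgf⟩
  rcases lt_or_ge t 0 with ht | ht
  · simpa using integrable_exp_neg_mul hm hpos (neg_pos.2 ht)
  -- A non-integrable function would have integral 0 by default, whereas the series of nonnegative
  -- terms has sum at least its zeroth term 1.
  · refine Integrable.of_integral_ne_zero (ne_of_gt ?_)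
    have := le_hasSum (hmgf t) 0 fun n _ =>
      div_nonneg (pow_nonneg ht n) (Real.Gamma_pos_of_pos (by positivity)).le
    refine lt_of_lt_of_le one_pos (le_trans (le_of_eq ?_) this)
    simp

end MittagLeffler

/-- The Cauchy density is even, so folding at 0 doubles it on the positive half-line. -/
lemma map_abs_cauchyMeasure :
    (cauchyMeasure 0 1).map (fun x => |x|) =
      (volume.restrict (Set.Ioi (0 : ℝ))).withDensity
        fun x => ENNReal.ofReal (2 / (Real.pi * (x ^ 2 + 1))) := by
  have hc : cauchyMeasure 0 1 = volume.withDensity (cauchyPDF 0 1) := by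
    simp [cauchyMeasure]
  ext A hA
  have habs : Measurable fun x : ℝ => |x| := measurable_norm
  have hA' : MeasurableSet ((fun x : ℝ => |x|) ⁻¹' A) := habs hA
  set g : ℝ → ENNReal := ((fun x : ℝ => |x|) ⁻¹' A).indicator (cauchyPDF 0 1) with hg
  have hgneg : ∀ x, g (-x) = g x := fun x => by
    by_cases hx : |x| ∈ A <;>
      simp [hg, cauchyPDF, cauchyPDFReal, Set.mem_preimage, hx]
  have hsymm : ∫⁻ x in (Set.Ioi (0 : ℝ))ᶜ, g x = ∫⁻ x in Set.Ioi (0 : ℝ), g x := by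
    have h := (Measure.measurePreserving_neg (volume : Measure ℝ)).setLIntegral_comp_preimage_emb
      (MeasurableEquiv.neg ℝ).measurableEmbedding g (Set.Iic 0)
    rw [Set.compl_Ioi, ← h]
    simp only [hgneg, Set.neg_preimage, Set.neg_Iic, neg_zero]
    exact setLIntegral_congr Ioi_ae_eq_Ici.symm
  rw [Measure.map_apply habs hA, hc, withDensity_apply _ hA', withDensity_apply _ hA,
    Measure.restrict_restrict hA, ← lintegral_indicator hA', ← hg,
    ← lintegral_add_compl _ (measurableSet_Ioi (a := (0 : ℝ))), hsymm, ← two_mul,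
    ← Measure.restrict_restrict hA, ← lintegral_indicator hA,
    ← lintegral_const_mul' _ _ (by simp)]
  refine setLIntegral_congr_fun measurableSet_Ioi fun x hx => ?_
  have hx0 : (0 : ℝ) < x := hx
  by_cases hxA : x ∈ A
  · have e : 2 / (Real.pi * (x ^ 2 + 1)) = 2 * cauchyPDFReal 0 1 x := by
      simp [cauchyPDFReal, div_eq_mul_inv, mul_comm]
    simp [hg, Set.indicator, abs_of_pos hx0, hxA, cauchyPDF, e, ENNReal.ofReal_mul]
  · simp [hg, Set.indicator, abs_of_pos hx0, hxA]

/-! ### Reflection formula and parameters of Gamma quotients -/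

noncomputable section

lemma Gamma_one_sub_mul_Gamma_one_add {u : ℂ} (hu : u ≠ 0) :
    Complex.Gamma (1 - u) * Complex.Gamma (1 + u) = u * (Real.pi / Complex.sin (Real.pi * u)) := by
  rw [add_comm 1 u, Complex.Gamma_add_one u hu, ← Complex.Gamma_mul_Gamma_one_sub]
  ring

/-- Euler's reflection formula above and below, where π cancels. Nonzero integers need no exclusion:
there the default value 0 of Γ at its poles matches that of division by 0. -/
lemma Gamma_quotient_eq_sin {u v : ℂ} (hu : u ≠ 0) (hv : v ≠ 0) :
    Complex.Gamma (1 - u) * Complex.Gamma (1 + u) / (Complex.Gamma (1 - v) * Complex.Gamma (1 + v)) =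
      u * Complex.sin (Real.pi * v) / (v * Complex.sin (Real.pi * u)) := by
  have hpi : (Real.pi : ℂ) ≠ 0 := by exact_mod_cast Real.pi_ne_zero
  rw [Gamma_one_sub_mul_Gamma_one_add hu, Gamma_one_sub_mul_Gamma_one_add hv]
  simp only [div_eq_mul_inv, mul_inv, inv_inv]
  field_simp

/-- Data of `C Γ(1 - p s) Γ(1 + c + p s) / (Γ(1 - q s) Γ(1 + d + q s))`. -/
def reflectedGammaData (C p q c d : ℝ) (hp : 0 < p) (hq : 0 < q) : GammaData where
  J := 2
  K := 2
  C := C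
  D := 1
  a := ![-p, p]
  b := ![1, 1 + c]
  a' := ![-q, q]
  b' := ![1, 1 + d]
  D_pos := one_pos
  a_ne j := by fin_cases j <;> simp [hp.ne']
  a'_ne j := by fin_cases j <;> simp [hq.ne']

section reflectedGammaData

variable (C c d : ℝ) {p q : ℝ} (hp : 0 < p) (hq : 0 < q)

lemma reflectedGammaData_fn (s : ℂ) : (reflectedGammaData C p q c d hp hq).fn s =
    C * (Complex.Gamma (1 - p * s) * Complex.Gamma (1 + p * s + c) /
      (Complex.Gamma (1 - q * s) * Complex.Gamma (1 + q * s + d))) := by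
  change (C : ℂ) * ((1 : ℝ) : ℂ) ^ s *
    (∏ j : Fin 2, Complex.Gamma ((![-p, p] j : ℝ) * s + (![1, 1 + c] j : ℝ))) /
    (∏ j : Fin 2, Complex.Gamma ((![-q, q] j : ℝ) * s + (![1, 1 + d] j : ℝ))) = _
  simp only [Fin.prod_univ_two, Matrix.cons_val_zero, Matrix.cons_val_one, Complex.ofReal_one,
    Complex.one_cpow, mul_one, mul_div_assoc, Complex.ofReal_neg, Complex.ofReal_add]
  ring_nf

lemma reflectedGammaData_gam : (reflectedGammaData C p q c d hp hq).gam = 2 * p - 2 * q := by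
  change ∑ j : Fin 2, |(![-p, p] j : ℝ)| - ∑ j : Fin 2, |(![-q, q] j : ℝ)| = _
  simp only [Fin.sum_univ_two, Matrix.cons_val_zero, Matrix.cons_val_one, abs_neg, abs_of_pos hp,
    abs_of_pos hq]
  ring

lemma reflectedGammaData_gam' : (reflectedGammaData C p q c d hp hq).gam' = 0 := by
  change ∑ j : Fin 2, (![-p, p] j : ℝ) - ∑ j : Fin 2, (![-q, q] j : ℝ) = _
  simp [Fin.sum_univ_two]

lemma reflectedGammaData_del : (reflectedGammaData C p q c d hp hq).del = c - d := by
  change ∑ j : Fin 2, (![1, 1 + c] j : ℝ) - ∑ j : Fin 2, (![1, 1 + d] j : ℝ) -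
    (((2 : ℕ) : ℝ) - (2 : ℕ)) / 2 = _
  simp only [Fin.sum_univ_two, Matrix.cons_val_zero, Matrix.cons_val_one]
  ring

lemma reflectedGammaData_kap : (reflectedGammaData C p q c d hp hq).kap = 0 := by
  change ∑ j : Fin 2, (![-p, p] j : ℝ) * Real.log |(![-p, p] j : ℝ)| -
    ∑ j : Fin 2, (![-q, q] j : ℝ) * Real.log |(![-q, q] j : ℝ)| + Real.log 1 = _
  simp [Fin.sum_univ_two]

lemma reflectedGammaData_C₁ : (reflectedGammaData C p q 0 0 hp hq).C₁ = C * (p / q) := by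
  have h : ∀ x : ℝ, 0 < x → x ^ (1 - 1 / 2 : ℝ) * x ^ (1 - 1 / 2 : ℝ) = x := fun x hx => by
    rw [← Real.rpow_add hx]; norm_num
  change C * (2 * Real.pi) ^ ((((2 : ℕ) : ℝ) - (2 : ℕ)) / 2) *
    (∏ j : Fin 2, |(![-p, p] j : ℝ)| ^ ((![1, 1 + 0] j : ℝ) - 1 / 2)) /
    (∏ j : Fin 2, |(![-q, q] j : ℝ)| ^ ((![1, 1 + 0] j : ℝ) - 1 / 2)) = _
  simp only [Fin.prod_univ_two, Matrix.cons_val_zero, Matrix.cons_val_one, abs_neg, abs_of_pos hp,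
    abs_of_pos hq, add_zero, h p hp, h q hq, sub_self, zero_div, Real.rpow_zero, mul_one,
    mul_div_assoc]

end reflectedGammaData

variable {Ω : Type*} [MeasurableSpace Ω] {μ : Measure Ω}

/-! ### Powers of the quotient of two independent stable variables -/

section Lamperti

variable {S S' : Ω → ℝ} {α : ℝ}

lemma ae_pos_div (hS : ∀ᵐ ω ∂μ, 0 < S ω) (hS' : ∀ᵐ ω ∂μ, 0 < S' ω) :
    ∀ᵐ ω ∂μ, 0 < S ω / S' ω := by
  filter_upwards [hS, hS'] with ω h1 h2 using div_pos h1 h2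

lemma ae_pos_rpow (hS : ∀ᵐ ω ∂μ, 0 < S ω) (p : ℝ) : ∀ᵐ ω ∂μ, 0 < S ω ^ p := by
  filter_upwards [hS] with ω h1 using Real.rpow_pos_of_pos h1 p

variable [IsProbabilityMeasure μ] (h : IsPositiveStable α S μ) (h' : IsPositiveStable α S' μ) (hind : IndepFun S S' μ)
  (hα : 0 < α)
include h h' hind hα

lemma hasMoment_stable_div {s : ℂ} (h1 : -α < s.re) (h2 : s.re < α) :
    HasMoment μ (fun ω => S ω / S' ω) s
      (Complex.Gamma (1 - s / α) * Complex.Gamma (1 + s / α) /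
        (Complex.Gamma (1 - s) * Complex.Gamma (1 + s))) := by
  have := (h.hasMoment hα h2).div h.pos h'.pos hind
    (h'.hasMoment hα (s := -s) (by simp; linarith))
  rw [div_mul_div_comm, neg_div, sub_neg_eq_add, sub_neg_eq_add] at this
  exact this

lemma cmoment_stable_div {s : ℂ} (h1 : -α < s.re) (h2 : s.re < α) :
    cmoment μ (fun ω => S ω / S' ω) s = cmoment μ S s * cmoment μ S (-s) := by
  have hs : (-s).re < α := by simp; linarith
  rw [(hasMoment_stable_div h h' hind hα h1 h2).2, (h.hasMoment hα h2).2, (h.hasMoment hα hs).2,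
    div_mul_div_comm, neg_div, sub_neg_eq_add, sub_neg_eq_add]

/-- The free power p treats three cases at once: p = 1 and p = α for the Lamperti variables, and p =
1/β with index α/β for the Kotz–Ostrovskii variables. -/
lemma hasMoment_stable_div_rpow {p : ℝ} (hp : 0 < p) {s : ℂ} (h1 : -(α / p) < s.re)
    (h2 : s.re < α / p) :
    HasMoment μ (fun ω => (S ω / S' ω) ^ p) s
      (Complex.Gamma (1 - p * s / α) * Complex.Gamma (1 + p * s / α) /
        (Complex.Gamma (1 - p * s) * Complex.Gamma (1 + p * s))) := by
  refine HasMoment.rpow (ae_pos_div h.pos h'.pos) (hasMoment_stable_div h h' hind hα ?_ ?_)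
  · rw [Complex.re_ofReal_mul]
    rw [← neg_div, div_lt_iff₀ hp] at h1
    linarith
  · rw [Complex.re_ofReal_mul]
    rw [lt_div_iff₀ hp] at h2
    linarith

lemma cmoment_stable_div_rpow_eq_sin {p : ℝ} (hp : 0 < p) {s : ℂ} (h1 : -(α / p) < s.re)
    (h2 : s.re < α / p) (hs : s ≠ 0) :
    cmoment μ (fun ω => (S ω / S' ω) ^ p) s =
      Complex.sin (Real.pi * (p * s)) / (α * Complex.sin (Real.pi * (p * s / α))) := by
  have hα' : (α : ℂ) ≠ 0 := by exact_mod_cast hα.ne'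
  have hp' : (p : ℂ) ≠ 0 := by exact_mod_cast hp.ne'
  rw [(hasMoment_stable_div_rpow h h' hind hα hp h1 h2).2,
    Gamma_quotient_eq_sin (div_ne_zero (mul_ne_zero hp' hs) hα') (mul_ne_zero hp' hs)]
  simp only [div_eq_mul_inv, mul_inv]
  field_simp

lemma integrable_stable_div_rpow {p : ℝ} (hp : 0 < p) {s : ℝ} (h1 : -(α / p) < s)
    (h2 : s < α / p) : Integrable (fun ω => ((S ω / S' ω) ^ p) ^ s) μ := by
  have hm : AEMeasurable (fun ω => (S ω / S' ω) ^ p) μ :=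
    (h.aemeasurable.div h'.aemeasurable).pow_const p
  simpa using (hasMoment_stable_div_rpow h h' hind hα hp (s := s) (by simpa using h1)
    (by simpa using h2)).integrable_rpow hm (ae_pos_rpow (ae_pos_div h.pos h'.pos) p)

lemma lt_of_integrable_stable_div_rpow (hα1 : α < 1) {p : ℝ} (hp : 0 < p) {s : ℝ}
    (hs : Integrable (fun ω => ((S ω / S' ω) ^ p) ^ s) μ) : -(α / p) < s ∧ s < α / p := by
  rw [integrable_rpow_rpow_iff (ae_pos_div h.pos h'.pos)] at hs
  obtain ⟨i1, i2⟩ :=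
    integrable_rpow_left_of_div h.aemeasurable h'.aemeasurable h.pos h'.pos hind hs
  have l1 := h.lt_of_integrable_rpow hα hα1 i1
  have l2 := h'.lt_of_integrable_rpow hα hα1 i2
  rw [← neg_div, div_lt_iff₀ hp, lt_div_iff₀ hp]
  constructor <;> linarith

lemma rhoPlus_stable_div_rpow (hα1 : α < 1) {p : ℝ} (hp : 0 < p) :
    rhoPlus μ (fun ω => (S ω / S' ω) ^ p) = ((α / p : ℝ) : EReal) :=
  rhoPlus_eq (b := -(α / p)) (by have := div_pos hα hp; linarith)
    (fun _ h1 h2 => integrable_stable_div_rpow h h' hind hα hp h1 h2)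
    (fun _ hs => (lt_of_integrable_stable_div_rpow h h' hind hα hα1 hp hs).2)

lemma rhoMinus_stable_div_rpow (hα1 : α < 1) {p : ℝ} (hp : 0 < p) :
    rhoMinus μ (fun ω => (S ω / S' ω) ^ p) = ((-(α / p) : ℝ) : EReal) :=
  rhoMinus_eq (b := α / p) (by have := div_pos hα hp; linarith)
    (fun _ h1 h2 => integrable_stable_div_rpow h h' hind hα hp h1 h2)
    (fun _ hs => (lt_of_integrable_stable_div_rpow h h' hind hα hα1 hp hs).1)

lemma isGammaType_stable_div_rpow {p : ℝ} (hp : 0 < p) :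
    IsGammaType μ (fun ω => (S ω / S' ω) ^ p) {s | -(α / p) < s.re ∧ s.re < α / p}
      (reflectedGammaData 1 (p / α) p 0 0 (div_pos hp hα) hp) := by
  refine ⟨ae_pos_rpow (ae_pos_div h.pos h'.pos) p, fun s hs => ?_⟩
  convert hasMoment_stable_div_rpow h h' hind hα hp hs.1 hs.2 using 1
  rw [reflectedGammaData_fn]
  push_cast
  simp only [one_mul, add_zero, div_mul_eq_mul_div]

lemma exists_gammaData_stable_div_rpow {p : ℝ} (hp : 0 < p) :
    ∃ g : GammaData,
      IsGammaType μ (fun ω => (S ω / S' ω) ^ p) {s | -(α / p) < s.re ∧ s.re < α / p} g ∧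
      g.gam = 2 * (p / α) - 2 * p ∧ g.gam' = 0 ∧ g.del = 0 ∧ g.kap = 0 ∧ g.C₁ = 1 / α := by
  refine ⟨_, isGammaType_stable_div_rpow h h' hind hα hp, reflectedGammaData_gam ..,
    reflectedGammaData_gam' .., ?_, reflectedGammaData_kap .., ?_⟩
  · rw [reflectedGammaData_del, sub_self]
  · rw [reflectedGammaData_C₁]
    field_simp

lemma integral_stable_div_rpow {p : ℝ} (hp : 0 < p) {s : ℝ} (h1 : -(α / p) < s)
    (h2 : s < α / p) (hs : s ≠ 0) :
    ∫ ω, ((S ω / S' ω) ^ p) ^ s ∂μ =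
      Real.sin (Real.pi * (p * s)) / (α * Real.sin (Real.pi * (p * s / α))) := by
  have := cmoment_stable_div_rpow_eq_sin h h' hind hα hp (s := s) (by simpa using h1)
    (by simpa using h2) (by exact_mod_cast hs)
  rw [cmoment_ofReal (ae_pos_rpow (ae_pos_div h.pos h'.pos) p)] at this
  exact_mod_cast this

/-- At angle θ = πα the normalised kernel has Mellin transform sin(παs) / (α sin(πs)), the moment of
the α-th power. -/
lemma hasPosDensity_stable_div_rpow (hα1 : α < 1) :
    HasPosDensity μ (fun ω => (S ω / S' ω) ^ α) (fun x =>
      Real.sin (Real.pi * α) / (Real.pi * α) *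
        (1 / (x ^ 2 + 2 * Real.cos (Real.pi * α) * x + 1))) := by
  have hθ : 0 < Real.pi * α := mul_pos Real.pi_pos hα
  have hθ' : Real.pi * α < Real.pi := by nlinarith [Real.pi_pos]
  have hsin := Real.sin_pos_of_pos_of_lt_pi hθ hθ'
  have hdiv : α / α = 1 := div_self hα.ne'
  refine hasPosDensity_of_rpow_moments ((h.aemeasurable.fun_div h'.aemeasurable).pow_const α)
    (ae_pos_rpow (ae_pos_div h.pos h'.pos) α) (by fun_prop) (fun x _ => ?_) one_pos
    (fun s hs => integrable_stable_div_rpow h h' hind hα hα (by rw [hdiv]; exact hs.1)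
      (by rw [hdiv]; exact hs.2)) (fun s hs => ?_) (fun s h0 h1 => ?_)
  · have := cauchyKernel_pos hθ hθ' x
    positivity
  · simp only [mul_left_comm _ (Real.sin (Real.pi * α) / (Real.pi * α))]
    exact (integrableOn_cauchyKernel hθ hθ' hs.1 hs.2).const_mul _
  · simp only [mul_left_comm _ (Real.sin (Real.pi * α) / (Real.pi * α))]
    rw [integral_const_mul, integral_cauchyKernel hθ hθ' h0 h1,
      integral_stable_div_rpow h h' hind hα hα (by rw [hdiv]; linarith) (by rw [hdiv]; exact h1)
        h0.ne', mul_div_cancel_left₀ _ hα.ne', mul_assoc Real.pi α s]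
    have := Real.pi_pos
    have : Real.sin (Real.pi * s) ≠ 0 :=
      (Real.sin_pos_of_pos_of_lt_pi (by positivity) (by nlinarith)).ne'
    field_simp

lemma hasPosDensity_stable_div (hα1 : α < 1) :
    HasPosDensity μ (fun ω => S ω / S' ω) (fun x =>
      Real.sin (Real.pi * α) / Real.pi *
        (x ^ (α - 1) / (x ^ (2 * α) + 2 * Real.cos (Real.pi * α) * x ^ α + 1))) := by
  have hθ : 0 < Real.pi * α := mul_pos Real.pi_pos hα
  have hθ' : Real.pi * α < Real.pi := by nlinarith [Real.pi_pos]
  have hsin := Real.sin_pos_of_pos_of_lt_pi hθ hθ'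
  have hsq : ∀ x : ℝ, 0 < x → x ^ (2 * α) = (x ^ α) ^ 2 := fun x hx => by
    rw [← Real.rpow_natCast, ← Real.rpow_mul hx.le, mul_comm]; norm_num
  -- The substitution y = x^α, with Jacobian αx^(α-1), carries the claimed density to the kernel and
  -- the exponent s to s/α.
  have hsub : ∀ s : ℝ, ∀ x ∈ Set.Ioi (0 : ℝ), (α * x ^ (α - 1)) •
      ((Real.sin (Real.pi * α) / (Real.pi * α)) * ((x ^ α) ^ (s / α) *
        (1 / ((x ^ α) ^ 2 + 2 * Real.cos (Real.pi * α) * x ^ α + 1)))) =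
      x ^ s * (Real.sin (Real.pi * α) / Real.pi *
        (x ^ (α - 1) / (x ^ (2 * α) + 2 * Real.cos (Real.pi * α) * x ^ α + 1))) := by
    intro s x hx
    have hx0 : (0 : ℝ) < x := hx
    rw [hsq x hx0, ← Real.rpow_mul hx0.le α (s / α), mul_div_cancel₀ _ hα.ne', smul_eq_mul]
    have := (cauchyKernel_pos hθ hθ' (x ^ α)).ne'
    field_simp
  have hp1 : ∀ {s : ℝ}, Integrable (fun ω => ((S ω / S' ω) ^ (1 : ℝ)) ^ s) μ →
      Integrable (fun ω => (S ω / S' ω) ^ s) μ := fun hs => by simpa only [Real.rpow_one] using hs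
  refine hasPosDensity_of_rpow_moments (h.aemeasurable.fun_div h'.aemeasurable)
    (ae_pos_div h.pos h'.pos) (by fun_prop) (fun x hx => ?_) hα
    (fun s hs => hp1 (integrable_stable_div_rpow h h' hind hα one_pos (by simpa using hs.1)
      (by simpa using hs.2))) (fun s hs => ?_) (fun s h0 h1 => ?_)
  · have := cauchyKernel_pos hθ hθ' (x ^ α)
    rw [hsq x hx]
    have := Real.pi_pos
    positivity
  · refine IntegrableOn.congr_fun ?_ (hsub s) measurableSet_Ioi
    have := (integrableOn_Ioi_comp_rpow_iff (fun y : ℝ =>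
      (Real.sin (Real.pi * α) / (Real.pi * α)) * (y ^ (s / α) *
        (1 / (y ^ 2 + 2 * Real.cos (Real.pi * α) * y + 1)))) hα.ne').2
      ((integrableOn_cauchyKernel hθ hθ' (by rw [lt_div_iff₀ hα]; linarith [hs.1])
        (by rw [div_lt_one hα]; exact hs.2)).const_mul _)
    rwa [abs_of_pos hα] at this
  · have := integral_stable_div_rpow h h' hind hα one_pos (s := s) (by rw [div_one]; linarith)
      (by rwa [div_one]) h0.ne'
    simp only [Real.rpow_one, one_mul] at this
    rw [this, ← setIntegral_congr_fun measurableSet_Ioi (hsub s),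
      integral_comp_rpow_Ioi_of_pos (g := fun y : ℝ =>
      (Real.sin (Real.pi * α) / (Real.pi * α)) * (y ^ (s / α) *
        (1 / (y ^ 2 + 2 * Real.cos (Real.pi * α) * y + 1)))) hα, integral_const_mul,
      integral_cauchyKernel hθ hθ' (by positivity) (by rw [div_lt_one hα]; exact h1),
      mul_assoc Real.pi α, mul_div_cancel₀ _ hα.ne']
    have := Real.pi_pos
    have hs1 : s / α < 1 := by rw [div_lt_one hα]; exact h1
    have : Real.sin (Real.pi * (s / α)) ≠ 0 :=
      (Real.sin_pos_of_pos_of_lt_pi (by positivity) (by nlinarith)).ne'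
    field_simp

end Lamperti

/-! ### Tilting by a power as a translation of the Mellin transform -/

section Tilt

variable {S T : Ω → ℝ} {θ : ℝ}

lemma ae_pos_of_hasLaw_powTilt (hS : ∀ᵐ ω ∂μ, 0 < S ω) (hm : AEMeasurable S μ)
    (hT : HasLaw T (powTilt (μ.map S) (-θ)) μ) : ∀ᵐ ω ∂μ, 0 < T ω := by
  have h1 : ∀ᵐ x ∂(μ.map S), 0 < x := (ae_map_iff hm measurableSet_Ioi).2 hS
  have h2 : ∀ᵐ x ∂(μ.map T), 0 < x := by
    rw [hT.map_eq]
    exact (withDensity_absolutelyContinuous _ _).ae_le h1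
  exact (ae_map_iff hT.aemeasurable measurableSet_Ioi).1 h2

lemma integral_rpow_pos [NeZero μ] (hS : ∀ᵐ ω ∂μ, 0 < S ω) (hi : Integrable (fun ω => S ω ^ (-θ)) μ) :
    0 < ∫ ω, S ω ^ (-θ) ∂μ := by
  refine (integral_nonneg_of_ae ?_).lt_of_ne fun h0 => not_ae_eq_zero_rpow hS (-θ) ?_
  · filter_upwards [hS] with ω hω using (Real.rpow_pos_of_pos hω _).le
  · refine (integral_eq_zero_iff_of_nonneg_ae ?_ hi).1 h0.symm
    filter_upwards [hS] with ω hω using (Real.rpow_pos_of_pos hω _).le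

variable [NeZero μ] (hS : ∀ᵐ ω ∂μ, 0 < S ω) (hm : AEMeasurable S μ)
  (hi : Integrable (fun ω => S ω ^ (-θ)) μ) (hT : HasLaw T (powTilt (μ.map S) (-θ)) μ)
include hS hm hi hT

/-- The weight x^(-θ)/c merges with x^s into x^(s-θ)/c. Since c is nonzero, integrability transfers
in both directions, which also locates the critical exponent of the tilted law. -/
lemma cpow_tilt_aux (s : ℂ) :
    (Integrable (fun ω => (T ω : ℂ) ^ s) μ ↔ Integrable (fun ω => (S ω : ℂ) ^ (s - θ)) μ) ∧
    cmoment μ T s = cmoment μ S (s - θ) / cmoment μ S (-θ) := by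
  have hc := integral_rpow_pos hS hi
  set c := ∫ ω, S ω ^ (-θ) ∂μ with hcdef
  have hcS : cmoment μ S (-θ) = c := by
    have := cmoment_ofReal hS (-θ)
    rwa [Complex.ofReal_neg] at this
  have hmap : ∫ y, y ^ (-θ) ∂(μ.map S) = c :=
    integral_map hm (Measurable.aestronglyMeasurable (by fun_prop))
  have hgm : ∀ ν : Measure ℝ, AEStronglyMeasurable (fun x : ℝ => (x : ℂ) ^ s) ν := fun ν =>
    Measurable.aestronglyMeasurable (by fun_prop)
  have hfm : Measurable fun x : ℝ => ENNReal.ofReal (x ^ (-θ) / c) := by fun_prop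
  have hft : ∀ᵐ x ∂(μ.map S), ENNReal.ofReal (x ^ (-θ) / c) < ⊤ :=
    Filter.Eventually.of_forall fun _ => ENNReal.ofReal_lt_top
  have hprod : AEStronglyMeasurable
      (fun x : ℝ => (ENNReal.ofReal (x ^ (-θ) / c)).toReal • (x : ℂ) ^ s) (μ.map S) :=
    Measurable.aestronglyMeasurable (by fun_prop)
  have hae : ∀ᵐ ω ∂μ, (ENNReal.ofReal (S ω ^ (-θ) / c)).toReal • (S ω : ℂ) ^ s =
      (S ω : ℂ) ^ (s - θ) / c := by
    filter_upwards [hS] with ω hω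
    have hω' : (S ω : ℂ) ≠ 0 := by exact_mod_cast hω.ne'
    rw [ENNReal.toReal_ofReal (by positivity), Complex.real_smul, Complex.ofReal_div,
      Complex.ofReal_cpow hω.le, sub_eq_add_neg, Complex.cpow_add _ _ hω', Complex.ofReal_neg]
    ring
  have hcC : (c : ℂ) ≠ 0 := by exact_mod_cast hc.ne'
  constructor
  · rw [← Function.comp_def (fun x : ℝ => (x : ℂ) ^ s) T,
      ← integrable_map_measure (hgm _) hT.aemeasurable, hT.map_eq, powTilt, hmap,
      integrable_withDensity_iff_integrable_smul' hfm hft, integrable_map_measure hprod hm, Function.comp_def, integrable_congr hae]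
    refine ⟨fun hI => ?_, fun hI => hI.div_const _⟩
    simpa [hcC] using hI.mul_const (c : ℂ)
  · rw [hcS, cmoment, cmoment, ← integral_map hT.aemeasurable (hgm _), hT.map_eq, powTilt, hmap,
      integral_withDensity_eq_integral_toReal_smul hfm hft, integral_map hm hprod,
      integral_congr_ae hae, integral_div]

end Tilt

/-! ### Tilted stable variables and James's quotients -/

section James

variable {Ω : Type*} [MeasurableSpace Ω] {μ : Measure Ω} [IsProbabilityMeasure μ]
  {S T : Ω → ℝ} {α θ : ℝ}

/-- Data of `C Γ(1 + c - p s) / Γ(1 + d - s)`. -/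
def tiltedGammaData (C p c d : ℝ) (hp : 0 < p) : GammaData where
  J := 1
  K := 1
  C := C
  D := 1
  a := ![-p]
  b := ![1 + c]
  a' := ![-1]
  b' := ![1 + d]
  D_pos := one_pos
  a_ne j := by fin_cases j; simp [hp.ne']
  a'_ne j := by fin_cases j; simp

lemma tiltedGammaData_fn (C c d : ℝ) {p : ℝ} (hp : 0 < p) (s : ℂ) :
    (tiltedGammaData C p c d hp).fn s =
      C * (Complex.Gamma (1 - p * s + c) / Complex.Gamma (1 - s + d)) := by
  change (C : ℂ) * ((1 : ℝ) : ℂ) ^ s *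
    (∏ j : Fin 1, Complex.Gamma ((![-p] j : ℝ) * s + (![1 + c] j : ℝ))) /
    (∏ j : Fin 1, Complex.Gamma ((![-1] j : ℝ) * s + (![1 + d] j : ℝ))) = _
  simp only [Fin.prod_univ_one, Matrix.cons_val_zero, Complex.ofReal_one,
    Complex.one_cpow, mul_one, mul_div_assoc, Complex.ofReal_neg, Complex.ofReal_add]
  ring_nf

variable (hα : 0 < α) (hθ : -α < θ) (h : IsPositiveStable α S μ)
  (hT : HasLaw T (powTilt (μ.map S) (-θ)) μ)
include hα hθ h hT

lemma hasMoment_tilted {s : ℂ} (hs : s.re < α + θ) :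
    HasMoment μ T s
      (Complex.Gamma (1 + θ) / Complex.Gamma (1 + θ / α) *
        (Complex.Gamma (1 - s / α + θ / α) / Complex.Gamma (1 - s + θ))) ∧
    cmoment μ T s = cmoment μ S (s - θ) / cmoment μ S (-θ) := by
  have hi : Integrable (fun ω => S ω ^ (-θ)) μ := h.integrable_rpow hα (by linarith)
  obtain ⟨h1, h2⟩ := cpow_tilt_aux h.pos h.aemeasurable hi hT s
  have hs' : (s - θ).re < α := by simp; linarith
  have m1 := h.hasMoment hα hs'
  have m2 := h.hasMoment hα (s := -θ) (by simp; linarith)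
  refine ⟨⟨h1.2 m1.1, ?_⟩, h2⟩
  rw [h2, m1.2, m2.2, neg_div, sub_neg_eq_add, sub_neg_eq_add,
    show 1 - (s - θ) / α = 1 - s / α + θ / α by ring, show 1 - (s - θ) = 1 - s + θ by ring]
  rw [div_div_eq_mul_div]
  ring

lemma lt_of_integrable_tilted (hα1 : α < 1) {r : ℝ} (hr : Integrable (fun ω => T ω ^ r) μ) :
    r < α + θ := by
  have hi : Integrable (fun ω => S ω ^ (-θ)) μ := h.integrable_rpow hα (by linarith)
  have hTpos := ae_pos_of_hasLaw_powTilt h.pos h.aemeasurable hT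
  have h1 := (cpow_tilt_aux h.pos h.aemeasurable hi hT r).1.1
    ((integrable_cpow_iff hT.aemeasurable hTpos r).2 (by simpa using hr))
  have h2 := (integrable_cpow_iff h.aemeasurable h.pos _).1 h1
  have := h.lt_of_integrable_rpow hα hα1 h2
  simp only [Complex.sub_re, Complex.ofReal_re] at this
  linarith

lemma isGammaType_tilted :
    IsGammaType μ T {s | s.re < α + θ}
      (tiltedGammaData (Real.Gamma (1 + θ) / Real.Gamma (1 + θ / α)) (1 / α) (θ / α) θ
        (one_div_pos.2 hα)) := by
  refine ⟨ae_pos_of_hasLaw_powTilt h.pos h.aemeasurable hT, fun s hs => ?_⟩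
  convert (hasMoment_tilted hα hθ h hT hs).1 using 1
  rw [tiltedGammaData_fn, Complex.ofReal_div, ← Complex.Gamma_ofReal, ← Complex.Gamma_ofReal]
  push_cast
  simp only [one_div_mul_eq_div]

variable (hind : IndepFun S T μ)
include hind

lemma hasMoment_james {s : ℂ} (h1 : -α - θ < s.re) (h2 : s.re < α) :
    HasMoment μ (fun ω => S ω / T ω) s
      (Complex.Gamma (1 + θ) / Complex.Gamma (1 + θ / α) *
        (Complex.Gamma (1 - s / α) * Complex.Gamma (1 + s / α + θ / α) /
          (Complex.Gamma (1 - s) * Complex.Gamma (1 + s + θ)))) ∧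
    cmoment μ (fun ω => S ω / T ω) s = cmoment μ S s * cmoment μ T (-s) := by
  have hTpos := ae_pos_of_hasLaw_powTilt h.pos h.aemeasurable hT
  have m1 := h.hasMoment hα h2
  have m2 := (hasMoment_tilted hα hθ h hT (s := -s) (by simp; linarith)).1
  have m := m1.div h.pos hTpos hind m2
  refine ⟨?_, by rw [m.2, m1.2, m2.2]⟩
  rwa [neg_div, sub_neg_eq_add, sub_neg_eq_add, mul_left_comm, div_mul_div_comm] at m

lemma isGammaType_james :
    IsGammaType μ (fun ω => S ω / T ω) {s | -α - θ < s.re ∧ s.re < α}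
      (reflectedGammaData (Real.Gamma (1 + θ) / Real.Gamma (1 + θ / α)) (1 / α) 1 (θ / α) θ
        (one_div_pos.2 hα) one_pos) := by
  refine ⟨ae_pos_div h.pos (ae_pos_of_hasLaw_powTilt h.pos h.aemeasurable hT), fun s hs => ?_⟩
  convert (hasMoment_james hα hθ h hT hind hs.1 hs.2).1 using 1
  rw [reflectedGammaData_fn, Complex.ofReal_div, ← Complex.Gamma_ofReal, ← Complex.Gamma_ofReal]
  push_cast
  simp only [one_div_mul_eq_div, one_mul]

lemma integrable_james {s : ℝ} (h1 : -α - θ < s) (h2 : s < α) :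
    Integrable (fun ω => (S ω / T ω) ^ s) μ := by
  have hTpos := ae_pos_of_hasLaw_powTilt h.pos h.aemeasurable hT
  simpa using (hasMoment_james hα hθ h hT hind (s := s) (by simpa using h1)
    (by simpa using h2)).1.integrable_rpow (h.aemeasurable.fun_div hT.aemeasurable)
    (ae_pos_div h.pos hTpos)

/-- The numerator forces s < α; the tilted denominator, with exponent -s, forces -s < α + θ. -/
lemma lt_of_integrable_james (hα1 : α < 1) {s : ℝ}
    (hs : Integrable (fun ω => (S ω / T ω) ^ s) μ) : -α - θ < s ∧ s < α := by
  obtain ⟨i1, i2⟩ := integrable_rpow_left_of_div h.aemeasurable hT.aemeasurable h.pos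
    (ae_pos_of_hasLaw_powTilt h.pos h.aemeasurable hT) hind hs
  have l1 := h.lt_of_integrable_rpow hα hα1 i1
  have l2 := lt_of_integrable_tilted hα hθ h hT hα1 i2
  constructor <;> linarith

end James

end

end GammaMoments

/-! ### Assembly of the three families -/

open GammaMoments
theorem mainTheorem7 {Ω : Type*} [MeasurableSpace Ω] (μ : Measure Ω) [IsProbabilityMeasure μ] :
    -- the Lamperti variable `L_α = S_α / S'_α` and its power `L_α ^ α`
    (∀ (α : ℝ) (S S' : Ω → ℝ), 0 < α → α < 1 →
      IsPositiveStable α S μ → IsPositiveStable α S' μ → IndepFun S S' μ →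
      -- moments of `L_α`
      (∀ s : ℂ, -α < s.re → s.re < α →
        HasMoment μ (fun ω => S ω / S' ω) s
          (Complex.Gamma (1 - s / α) * Complex.Gamma (1 + s / α) /
            (Complex.Gamma (1 - s) * Complex.Gamma (1 + s))) ∧
        cmoment μ (fun ω => S ω / S' ω) s = cmoment μ S s * cmoment μ S (-s) ∧
        (s ≠ 0 →
          cmoment μ (fun ω => S ω / S' ω) s =
            Complex.Gamma (s / α) * Complex.Gamma (1 - s / α) /
              (α * Complex.Gamma s * Complex.Gamma (1 - s)) ∧
          cmoment μ (fun ω => S ω / S' ω) s =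
            Complex.sin (Real.pi * s) / (α * Complex.sin (Real.pi * s / α)))) ∧
      (∃ g : GammaData,
        IsGammaType μ (fun ω => S ω / S' ω) {s | -α < s.re ∧ s.re < α} g ∧
        g.gam = 2 * α⁻¹ - 2 ∧ g.gam' = 0 ∧ g.del = 0 ∧ g.kap = 0 ∧ g.C₁ = 1 / α) ∧
      rhoPlus μ (fun ω => S ω / S' ω) = (α : ℝ) ∧
      rhoMinus μ (fun ω => S ω / S' ω) = ((-α : ℝ) : EReal) ∧
      -- `L_α ^ α` as a quotient of independent Mittag-Leffler variables
      IsMittagLeffler α (fun ω => S ω ^ (-α)) μ ∧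
      IsMittagLeffler α (fun ω => S' ω ^ (-α)) μ ∧
      IndepFun (fun ω => S ω ^ (-α)) (fun ω => S' ω ^ (-α)) μ ∧
      (∀ᵐ ω ∂μ, (S ω / S' ω) ^ α = S' ω ^ (-α) / S ω ^ (-α)) ∧
      -- moments of `L_α ^ α`
      (∀ s : ℂ, -1 < s.re → s.re < 1 →
        HasMoment μ (fun ω => (S ω / S' ω) ^ α) s
          (Complex.Gamma (1 - s) * Complex.Gamma (1 + s) /
            (Complex.Gamma (1 - α * s) * Complex.Gamma (1 + α * s))) ∧
        (s ≠ 0 →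
          cmoment μ (fun ω => (S ω / S' ω) ^ α) s =
            Complex.sin (Real.pi * α * s) / (α * Complex.sin (Real.pi * s)))) ∧
      (∃ g : GammaData,
        IsGammaType μ (fun ω => (S ω / S' ω) ^ α) {s | -1 < s.re ∧ s.re < 1} g ∧
        g.gam = 2 - 2 * α ∧ g.gam' = 0 ∧ g.del = 0 ∧ g.kap = 0 ∧ g.C₁ = 1 / α) ∧
      rhoPlus μ (fun ω => (S ω / S' ω) ^ α) = ((1 : ℝ) : EReal) ∧
      rhoMinus μ (fun ω => (S ω / S' ω) ^ α) = ((-1 : ℝ) : EReal) ∧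
      -- densities of `L_α ^ α` and `L_α`
      HasPosDensity μ (fun ω => (S ω / S' ω) ^ α) (fun x =>
        Real.sin (Real.pi * α) / (Real.pi * α) *
          (1 / (x ^ 2 + 2 * Real.cos (Real.pi * α) * x + 1))) ∧
      HasPosDensity μ (fun ω => S ω / S' ω) (fun x =>
        Real.sin (Real.pi * α) / Real.pi *
          (x ^ (α - 1) / (x ^ (2 * α) + 2 * Real.cos (Real.pi * α) * x ^ α + 1))) ∧
      -- the case `α = 1/2`
      (α = 1 / 2 →
        (∀ s : ℂ, -1 < s.re → s.re < 1 →
          cmoment μ (fun ω => (S ω / S' ω) ^ α) s = 1 / Complex.cos (Real.pi * s / 2)) ∧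
        HasLaw (fun ω => (S ω / S' ω) ^ α) ((cauchyMeasure 0 1).map fun x => |x|) μ)) ∧
    -- the Kotz-Ostrovskii variable `Y_{α,β} = L_{α/β} ^ (1/β)`
    (∀ (α β : ℝ) (S S' : Ω → ℝ), 0 < α → α < β → β ≤ 2 →
      IsPositiveStable (α / β) S μ → IsPositiveStable (α / β) S' μ → IndepFun S S' μ →
      (∀ᵐ ω ∂μ, ((S ω / S' ω) ^ (α / β)) ^ (1 / α) = (S ω / S' ω) ^ (1 / β)) ∧
      (∀ s : ℂ, -α < s.re → s.re < α →
        HasMoment μ (fun ω => (S ω / S' ω) ^ (1 / β)) s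
          (Complex.Gamma (1 + s / α) * Complex.Gamma (1 - s / α) /
            (Complex.Gamma (1 + s / β) * Complex.Gamma (1 - s / β))) ∧
        cmoment μ (fun ω => (S ω / S' ω) ^ (1 / β)) s =
          cmoment μ (fun ω => S ω / S' ω) (s / β) ∧
        (s ≠ 0 →
          cmoment μ (fun ω => (S ω / S' ω) ^ (1 / β)) s =
            β * Complex.sin (Real.pi * s / β) / (α * Complex.sin (Real.pi * s / α)))) ∧
      (∃ g : GammaData,
        IsGammaType μ (fun ω => (S ω / S' ω) ^ (1 / β)) {s | -α < s.re ∧ s.re < α} g ∧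
        g.gam = 2 * α⁻¹ - 2 * β⁻¹ ∧ g.gam' = 0 ∧ g.del = 0 ∧ g.kap = 0 ∧ g.C₁ = β / α) ∧
      rhoPlus μ (fun ω => (S ω / S' ω) ^ (1 / β)) = (α : ℝ) ∧
      rhoMinus μ (fun ω => (S ω / S' ω) ^ (1 / β)) = ((-α : ℝ) : EReal)) ∧
    -- James's variable `X_{α,θ} = S_α / S_{α,θ}`
    (∀ (α θ : ℝ) (S T : Ω → ℝ), 0 < α → α < 1 → -α < θ →
      IsPositiveStable α S μ → HasLaw T (powTilt (μ.map S) (-θ)) μ → IndepFun S T μ →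
      -- the tilting is well defined: `0 < E S_α ^ (-θ) < ∞`
      Integrable (fun ω => S ω ^ (-θ)) μ ∧ 0 < ∫ ω, S ω ^ (-θ) ∂μ ∧
      -- moments of the tilted variable
      (∀ s : ℂ, s.re < α + θ →
        HasMoment μ T s
          (Complex.Gamma (1 + θ) / Complex.Gamma (1 + θ / α) *
            (Complex.Gamma (1 - s / α + θ / α) / Complex.Gamma (1 - s + θ))) ∧
        cmoment μ T s = cmoment μ S (s - θ) / cmoment μ S (-θ)) ∧
      (∃ g : GammaData, IsGammaType μ T {s | s.re < α + θ} g) ∧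
      -- moments of `X_{α,θ}`
      (∀ s : ℂ, -α - θ < s.re → s.re < α →
        HasMoment μ (fun ω => S ω / T ω) s
          (Complex.Gamma (1 + θ) / Complex.Gamma (1 + θ / α) *
            (Complex.Gamma (1 - s / α) * Complex.Gamma (1 + s / α + θ / α) /
              (Complex.Gamma (1 - s) * Complex.Gamma (1 + s + θ)))) ∧
        cmoment μ (fun ω => S ω / T ω) s = cmoment μ S s * cmoment μ T (-s)) ∧
      (∃ g : GammaData,
        IsGammaType μ (fun ω => S ω / T ω) {s | -α - θ < s.re ∧ s.re < α} g ∧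
        g.gam = 2 * (1 / α - 1) ∧ g.gam' = 0 ∧ g.del = θ * (1 / α - 1) ∧ g.kap = 0) ∧
      rhoPlus μ (fun ω => S ω / T ω) = (α : ℝ) ∧
      rhoMinus μ (fun ω => S ω / T ω) = ((-α - θ : ℝ) : EReal)) := by
  refine ⟨fun α S S' hα hα1 h h' hind => ?_, fun α β S S' hα hαβ _ h h' hind => ?_,
    fun α θ S T hα hα1 hθ h hT hind => ?_⟩
  · have hα0 : (α : ℂ) ≠ 0 := by exact_mod_cast hα.ne'
    have hdiv : α / α = 1 := div_self hα.ne'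
    have sin1 := fun (s : ℂ) => cmoment_stable_div_rpow_eq_sin h h' hind hα one_pos (s := s)
    have rp := rhoPlus_stable_div_rpow h h' hind hα hα1 one_pos
    have rm := rhoMinus_stable_div_rpow h h' hind hα hα1 one_pos
    have gt := exists_gammaData_stable_div_rpow h h' hind hα one_pos
    simp only [Real.rpow_one, div_one, Complex.ofReal_one, one_mul, mul_one, one_div]
      at sin1 rp rm gt
    have rp' := rhoPlus_stable_div_rpow h h' hind hα hα1 hα
    have rm' := rhoMinus_stable_div_rpow h h' hind hα hα1 hα
    have gt' := exists_gammaData_stable_div_rpow h h' hind hα hα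
    rw [hdiv] at rp' rm' gt'
    have mom' : ∀ s : ℂ, -1 < s.re → s.re < 1 →
        HasMoment μ (fun ω => (S ω / S' ω) ^ α) s
          (Complex.Gamma (1 - s) * Complex.Gamma (1 + s) /
            (Complex.Gamma (1 - α * s) * Complex.Gamma (1 + α * s))) := fun s h1 h2 => by
      have := hasMoment_stable_div_rpow h h' hind hα hα (s := s) (by rwa [hdiv]) (by rwa [hdiv])
      rwa [mul_div_cancel_left₀ _ hα0] at this
    have sin' : ∀ s : ℂ, -1 < s.re → s.re < 1 → s ≠ 0 →
        cmoment μ (fun ω => (S ω / S' ω) ^ α) s =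
          Complex.sin (Real.pi * α * s) / (α * Complex.sin (Real.pi * s)) := fun s h1 h2 hs => by
      rw [cmoment_stable_div_rpow_eq_sin h h' hind hα hα (by rwa [hdiv]) (by rwa [hdiv]) hs,
        mul_div_cancel_left₀ _ hα0, mul_assoc]
    have dens := hasPosDensity_stable_div_rpow h h' hind hα hα1
    refine ⟨fun s h1 h2 => ⟨hasMoment_stable_div h h' hind hα h1 h2,
        cmoment_stable_div h h' hind hα h1 h2, fun hs => ⟨?_, ?_⟩⟩,
      ?_, rp, rm, h.isMittagLeffler hα, h'.isMittagLeffler hα,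
      hind.comp (φ := fun x : ℝ => x ^ (-α)) (ψ := fun x : ℝ => x ^ (-α)) (by fun_prop)
        (by fun_prop), ?_, fun s h1 h2 => ⟨mom' s h1 h2, sin' s h1 h2⟩,
      ?_, rp', rm', dens, hasPosDensity_stable_div h h' hind hα hα1, fun hhalf => ⟨?_, ?_⟩⟩
    · rw [(hasMoment_stable_div h h' hind hα h1 h2).2, add_comm 1 (s / α), add_comm 1 s,
        Complex.Gamma_add_one _ hs, Complex.Gamma_add_one _ (div_ne_zero hs hα0)]
      simp only [div_eq_mul_inv, mul_inv]
      field_simp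
    · rw [sin1 s h1 h2 hs, mul_div_assoc]
    · simpa only [div_eq_mul_inv, one_mul] using gt
    · filter_upwards [h.pos, h'.pos] with ω h1 h2
      rw [Real.div_rpow h1.le h2.le, Real.rpow_neg h1.le, Real.rpow_neg h2.le, div_inv_eq_mul,
        mul_comm, div_eq_mul_inv]
    · simpa only [mul_one] using gt'
    · intro s h1 h2
      -- The sine quotient is 0/0 at s = 0, where the Gamma form is used instead.
      rcases eq_or_ne s 0 with rfl | hs
      · rw [(mom' 0 h1 h2).2]; simp
      · rw [sin' s h1 h2 hs, hhalf]
        have hpi : (Real.pi : ℂ) ≠ 0 := by exact_mod_cast Real.pi_ne_zero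
        -- The zeros of sin(πs/2) are the even integers, and only 0 lies in the strip; this factor
        -- then cancels through the double-angle formula.
        have hsin : Complex.sin (Real.pi * s / 2) ≠ 0 := by
          rw [Complex.sin_ne_zero_iff]
          intro k hk
          have hk' : s = ((2 * k : ℤ) : ℂ) := by
            apply mul_left_cancel₀ hpi
            push_cast
            linear_combination 2 * hk
          have hre : s.re = ((2 * k : ℤ) : ℝ) := by rw [hk', Complex.intCast_re]
          rw [hre] at h1 h2
          have h1' : -1 < 2 * k := by exact_mod_cast h1
          have h2' : 2 * k < 1 := by exact_mod_cast h2
          obtain rfl : k = 0 := by omega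
          exact hs (by simpa using hk')
        have e1 : (Real.pi : ℂ) * ((1 / 2 : ℝ) : ℂ) * s = Real.pi * s / 2 := by push_cast; ring
        have e2 : Complex.sin (Real.pi * s) =
            2 * Complex.sin (Real.pi * s / 2) * Complex.cos (Real.pi * s / 2) := by
          rw [← Complex.sin_two_mul]; ring_nf
        rw [e1, e2]
        simp only [div_eq_mul_inv, mul_inv]
        push_cast
        field_simp
    · rw [map_abs_cauchyMeasure]
      have e : (fun x : ℝ => Real.sin (Real.pi * α) / (Real.pi * α) *
          (1 / (x ^ 2 + 2 * Real.cos (Real.pi * α) * x + 1))) =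
          fun x => 2 / (Real.pi * (x ^ 2 + 1)) := by
        funext x
        rw [hhalf, show Real.pi * (1 / 2) = Real.pi / 2 by ring, Real.sin_pi_div_two,
          Real.cos_pi_div_two, mul_zero, zero_mul, add_zero]
        have := Real.pi_ne_zero
        field_simp
      rw [e] at dens
      exact dens
  · have hβ : 0 < β := hα.trans hαβ
    have ha : 0 < α / β := div_pos hα hβ
    have ha1 : α / β < 1 := (div_lt_one hβ).2 hαβ
    have hp : 0 < 1 / β := one_div_pos.2 hβ
    have hα0 : (α : ℂ) ≠ 0 := by exact_mod_cast hα.ne'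
    have hβ0 : (β : ℂ) ≠ 0 := by exact_mod_cast hβ.ne'
    -- Index α/β and power 1/β give a strip of half-width α.
    have hdiv : α / β / (1 / β) = α := by field_simp
    have e1 : ∀ s : ℂ, ((1 / β : ℝ) : ℂ) * s = s / β := fun s => by push_cast; ring
    have e2 : ∀ s : ℂ, s / β / ((α / β : ℝ) : ℂ) = s / α := fun s => by push_cast; field_simp
    have mom := fun s : ℂ => hasMoment_stable_div_rpow h h' hind ha hp (s := s)
    have sn := fun s : ℂ => cmoment_stable_div_rpow_eq_sin h h' hind ha hp (s := s)
    have rp := rhoPlus_stable_div_rpow h h' hind ha ha1 hp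
    have rm := rhoMinus_stable_div_rpow h h' hind ha ha1 hp
    have gt := exists_gammaData_stable_div_rpow h h' hind ha hp
    simp only [hdiv, e1, e2] at mom sn rp rm gt
    refine ⟨?_, fun s h1 h2 => ⟨?_, ?_, fun hs => ?_⟩, ?_, rp, rm⟩
    · filter_upwards [ae_pos_div h.pos h'.pos] with ω hω
      rw [← Real.rpow_mul hω.le]
      congr 1
      field_simp
    · rw [mul_comm (Complex.Gamma (1 + s / α)), mul_comm (Complex.Gamma (1 + s / β))]
      exact mom s h1 h2
    · rw [(mom s h1 h2).2]
      have hre : (s / β).re = s.re / β := Complex.div_ofReal_re s β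
      rw [(hasMoment_stable_div h h' hind ha (s := s / β)
        (by rw [hre, ← neg_div]; exact div_lt_div_of_pos_right h1 hβ)
        (by rw [hre]; exact div_lt_div_of_pos_right h2 hβ)).2, e2]
    · rw [sn s h1 h2 hs, mul_div_assoc, mul_div_assoc]
      push_cast
      simp only [div_eq_mul_inv, mul_inv, inv_inv]
      ring_nf
    · obtain ⟨g, hg, g1, g2, g3, g4, g5⟩ := gt
      refine ⟨g, hg, ?_, g2, g3, g4, ?_⟩
      · rw [g1]; field_simp
      · rw [g5]; field_simp
  · have hi : Integrable (fun ω => S ω ^ (-θ)) μ := h.integrable_rpow hα (by linarith)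
    refine ⟨hi, integral_rpow_pos h.pos hi, fun s hs => hasMoment_tilted hα hθ h hT hs,
      ⟨_, isGammaType_tilted hα hθ h hT⟩,
      fun s h1 h2 => hasMoment_james hα hθ h hT hind h1 h2,
      ⟨_, isGammaType_james hα hθ h hT hind, ?_, reflectedGammaData_gam' .., ?_,
        reflectedGammaData_kap ..⟩, ?_, ?_⟩
    · rw [reflectedGammaData_gam]; ring
    · rw [reflectedGammaData_del]; ring
    · exact rhoPlus_eq (b := -α - θ) (by linarith)
        (fun _ h1 h2 => integrable_james hα hθ h hT hind h1 h2)
        (fun _ hs => (lt_of_integrable_james hα hθ h hT hind hα1 hs).2)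
    · exact rhoMinus_eq (b := α) (by linarith)
        (fun _ h1 h2 => integrable_james hα hθ h hT hind h1 h2)
        (fun _ hs => (lt_of_integrable_james hα hθ h hT hind hα1 hs).1)
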